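/- Let $\mathcal{E}$ be a $2$-quasi-abelian category, that is, an additive category in which every morphism has a kernel and a cokernel. Let $K(\mathcal{E})$ be the homotopy category of unbounded cochain complexes in $\mathcal{E}$, and let $K^{\le n}(\mathcal{E})$ (respectively $K^{\ge n}(\mathcal{E})$) be the full subcategory of complexes isomorphic in $K(\mathcal{E})$ to complexes with zero entries in all degrees $>n$ (respectively $<n$). For a class $\mathcal{U}$ of objects write $\mathcal{U}^{\perp}=\{C \mid \mathrm{Hom}(U,C)=0\ \forall U\in\mathcal{U}\}$ and ${}^{\perp}\mathcal{U}=\{C\mid \mathrm{Hom}(C,U)=0\ \forall U\in\mathcal{U}\}$. Then $$\mathcal{L}\mathcal{K}_{\mathcal{E}}=\bigl(K^{\le 0}(\mathcal{E}),\,(K^{\le -1}(\mathcal{E}))^{\perp}\bigr),\qquad \mathcal{R}\mathcal{K}_{\mathcal{E}}=\bigl({}^{\perp}(K^{\ge 1}(\mathcal{E})),\,K^{\ge 0}(\mathcal{E})\bigr)$$ are $t$-structures on $K(\mathcal{E})$. Denote their hearts by $\mathcal{L}\mathcal{K}(\mathcal{E})$ and $\mathcal{R}\mathcal{K}(\mathcal{E})$.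 Then the following hold. (1) The functor placing an object of $\mathcal{E}$ in degree $0$ is fully faithful, and its essential image in $K(\mathcal{E})$, again denoted $\mathcal{E}$, is $\mathcal{E}=\mathcal{R}\mathcal{K}(\mathcal{E})\cap\mathcal{L}\mathcal{K}(\mathcal{E})$. (2) $(\mathcal{D},\mathcal{T})=(\mathcal{R}\mathcal{K}_{\mathcal{E}},\mathcal{L}\mathcal{K}_{\mathcal{E}})$ is a $2$-tilting pair of $t$-structures on $\mathcal{C}=K(\mathcal{E})$, meaning: $\mathcal{D}^{\le -2}\subseteq\mathcal{T}^{\le 0}\subseteq\mathcal{D}^{\le 0}$; a complex in $K(\mathcal{H}_{\mathcal{D}}\cap\mathcal{H}_{\mathcal{T}})$ is acyclic in the heart $\mathcal{H}_{\mathcal{D}}$ if and only if it is acyclic in the heart $\mathcal{H}_{\mathcal{T}}$, and, with $\mathcal{N}$ the class of these acyclic complexes, there are compatible triangle equivalences $\mathcal{C}\simeq D(\mathcal{H}_{\mathcal{D}})\simeq D(\mathcal{H}_{\mathcal{T}})\simeq K(\mathcal{H}_{\mathcal{D}}\cap\mathcal{H}_{\mathcal{T}})/\mathcal{N}$, where the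 equivalences $D(\mathcal{H}_{\mathcal{D}})\simeq\mathcal{C}$ and $D(\mathcal{H}_{\mathcal{T}})\simeq\mathcal{C}$ extend the inclusions of the hearts and carry the natural $t$-structures to $\mathcal{D}$ and $\mathcal{T}$, and those with $K(\mathcal{H}_{\mathcal{D}}\cap\mathcal{H}_{\mathcal{T}})/\mathcal{N}$ are induced by the inclusions of $\mathcal{H}_{\mathcal{D}}\cap\mathcal{H}_{\mathcal{T}}$ in the hearts; every object of $\mathcal{H}_{\mathcal{D}}$ is a subobject of an object of $\mathcal{H}_{\mathcal{D}}\cap\mathcal{H}_{\mathcal{T}}$, and every object of $\mathcal{H}_{\mathcal{T}}$ is a quotient of an object of $\mathcal{H}_{\mathcal{D}}\cap\mathcal{H}_{\mathcal{T}}$. (3) $\mathcal{E}$ is a $2$-tilting torsion class in $\mathcal{R}\mathcal{K}(\mathcal{E})$: it cogenerates $\mathcal{R}\mathcal{K}(\mathcal{E})$, is closed under extensions, has kernels, and for every exact sequence $0\to A\to X_1\to X_2\to B\to 0$ in $\mathcal{R}\mathcal{K}(\mathcal{E})$ with $X_1,X_2\in\mathcal{E}$ one has $B\in\mathcal{E}$.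 (4) $\mathcal{E}$ is a $2$-cotilting torsion-free class in $\mathcal{L}\mathcal{K}(\mathcal{E})$: it generates $\mathcal{L}\mathcal{K}(\mathcal{E})$, is closed under extensions, has cokernels, and is closed under kernels taken in $\mathcal{L}\mathcal{K}(\mathcal{E})$. (5) The projective objects of $\mathcal{L}\mathcal{K}(\mathcal{E})$ are exactly the objects of $\mathcal{E}$, every object of $\mathcal{L}\mathcal{K}(\mathcal{E})$ has a projective resolution of length at most $2$ by objects of $\mathcal{E}$, and the canonical functor $K(\mathcal{E})\to D(\mathcal{L}\mathcal{K}(\mathcal{E}))$ induced by $\mathcal{E}\hookrightarrow\mathcal{L}\mathcal{K}(\mathcal{E})$ is an equivalence. -/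

import Mathlib

open CategoryTheory CategoryTheory.Limits CategoryTheory.Triangulated
open CategoryTheory.Pretriangulated

universe v u

namespace TiltingPair

section Heart

variable {C : Type u} [Category.{v} C] [Preadditive C] [HasZeroObject C] [HasShift C ℤ]
  [∀ n : ℤ, (shiftFunctor C n).Additive] [Pretriangulated C]

lemma isLE_of_isLimit (t : TStructure C) (n : ℤ) {J : Type} [Finite J]
    {K : Discrete J ⥤ C} {c : Cone K} (hc : IsLimit c) (h : ∀ j, t.IsLE (K.obj j) n) :
    t.IsLE c.pt n := by
  rw [t.isLE_iff_isZero_truncGE_obj n (n + 1) rfl, IsZero.iff_id_eq_zero]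
  refine (isLimitOfPreserves (t.truncGE (n + 1)) hc).hom_ext (fun j ↦ ?_)
  exact IsZero.eq_of_tgt (t.isZero_truncGE_obj_of_isLE n (n + 1) rfl (K.obj j)) _ _

lemma isGE_of_isLimit (t : TStructure C) (n : ℤ) {J : Type} [Finite J]
    {K : Discrete J ⥤ C} {c : Cone K} (hc : IsLimit c) (h : ∀ j, t.IsGE (K.obj j) n) :
    t.IsGE c.pt n := by
  rw [t.isGE_iff_isZero_truncLT_obj n, IsZero.iff_id_eq_zero]
  refine (isLimitOfPreserves (t.truncLT n) hc).hom_ext (fun j ↦ ?_)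
  exact IsZero.eq_of_tgt (t.isZero_truncLT_obj_of_isGE n (K.obj j)) _ _

instance heart_containsZero (t : TStructure C) : t.heart.ContainsZero where
  exists_zero := ⟨_, isZero_zero C, (t.mem_heart_iff _).2 
    ⟨t.isLE_of_isZero (isZero_zero C) 0, t.isGE_of_isZero (isZero_zero C) 0⟩⟩

instance heart_isClosedUnderFiniteProducts (t : TStructure C) :
    t.heart.IsClosedUnderFiniteProducts where
  isClosedUnderLimitsOfShape _ _ :=
    ⟨fun _ ⟨p⟩ ↦ (t.mem_heart_iff _).2
      ⟨isLE_of_isLimit t 0 p.isLimit fun j ↦ ((t.mem_heart_iff _).1 (p.prop_diag_obj j)).1,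
        isGE_of_isLimit t 0 p.isLimit fun j ↦ ((t.mem_heart_iff _).1 (p.prop_diag_obj j)).2⟩⟩

lemma heart_hom_shift_eq_zero (t : TStructure C) ⦃X Y : t.heart.FullSubcategory⦄ ⦃n : ℤ⦄
    (f : t.heart.ι.obj X ⟶ (t.heart.ι.obj Y)⟦n⟧) (hn : n < 0) : f = 0 := by
  have hX := ((t.mem_heart_iff _).1 X.property).1
  have hY := ((t.mem_heart_iff _).1 Y.property).2
  exact t.zero_of_isLE_of_isGE f 0 (-n) (by lia) hX (t.isGE_shift Y.obj 0 n (-n) (by lia))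

lemma heart_admissibleMorphism (t : TStructure C) [IsTriangulated C] :
    AbelianSubcategory.admissibleMorphism t.heart.ι = ⊤ := by
  ext X₁ X₂ f
  refine ⟨fun _ ↦ trivial, fun _ X₃ f₂ f₃ hT ↦ ?_⟩
  have := ((t.mem_heart_iff _).1 X₁.property).1
  have := ((t.mem_heart_iff _).1 X₁.property).2
  have := ((t.mem_heart_iff _).1 X₂.property).1
  have := ((t.mem_heart_iff _).1 X₂.property).2
  have := t.isLE_shift X₁.obj 0 1 (-1)
  have : t.IsLE X₃ 0 := t.isLE₂ _ (rot_of_distTriang _ hT) 0 ‹t.IsLE X₂.obj 0›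
    (t.isLE_of_le (X₁.obj⟦(1 : ℤ)⟧) (-1) 0)
  have : t.IsGE X₃ (-1) := t.isGE₂ _ (rot_of_distTriang _ hT) (-1)
    (t.isGE_of_ge X₂.obj (-1) 0) (t.isGE_shift X₁.obj 0 1 (-1))
  have : t.IsLE ((t.truncLT 0).obj X₃) (-1) := t.isLE_truncLT_obj X₃ 0 (-1)
  let K : t.heart.FullSubcategory := ⟨((t.truncLT 0).obj X₃)⟦(-1 : ℤ)⟧,
    (t.mem_heart_iff _).2 ⟨t.isLE_shift _ (-1) (-1) 0, t.isGE_shift _ (-1) (-1) 0⟩⟩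
  let Q : t.heart.FullSubcategory := ⟨(t.truncGE 0).obj X₃,
    (t.mem_heart_iff _).2 ⟨inferInstance, inferInstance⟩⟩
  let e : K.obj⟦(1 : ℤ)⟧ ≅ (t.truncLT 0).obj X₃ :=
    (shiftEquiv C (1 : ℤ)).counitIso.app ((t.truncLT 0).obj X₃)
  have he : (shiftFunctor C (1 : ℤ)).map e.inv ≫ (shiftFunctor C (1 : ℤ)).map e.hom = 𝟙 _ := by
    rw [← Functor.map_comp, Iso.inv_hom_id, CategoryTheory.Functor.map_id]
  refine ⟨K, Q, e.hom ≫ (t.truncLTι 0).app X₃, (t.truncGEπ 0).app X₃,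
    (t.truncGEδLT 0).app X₃ ≫ (shiftFunctor C (1 : ℤ)).map e.inv, ?_⟩
  refine isomorphic_distinguished _ (t.triangleLTGE_distinguished 0 X₃) _ ?_
  refine Triangle.isoMk _ _ e (Iso.refl _) (Iso.refl _) (Category.comp_id _)
    ((Category.comp_id _).trans (Category.id_comp _).symm) ?_
  refine Eq.trans ?_ (Category.id_comp _).symm
  exact (Category.assoc _ _ _).trans
    ((congrArg ((t.truncGEδLT 0).app X₃ ≫ ·) he).trans (Category.comp_id _))

/-- The heart of a t-structure is an abelian category
(for the additive structure which it inherits as a full subcategory). -/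
noncomputable instance heartAbelian (t : TStructure C) [IsTriangulated C] :
    Abelian t.heart.FullSubcategory :=
  AbelianSubcategory.abelian t.heart.ι (heart_hom_shift_eq_zero t) (heart_admissibleMorphism t)

/-- The derived category of the heart is the localization of the category of unbounded complexes
at the quasi-isomorphisms. -/
noncomputable instance heartHasDerivedCategory (t : TStructure C) [IsTriangulated C] :
    HasDerivedCategory.{max u v} t.heart.FullSubcategory :=
  HasDerivedCategory.standard _

end Heart

section Classes

variable {A : Type u} [Category.{v} A] [Abelian A] (P : ObjectProperty A)

/-- Every object of `A` is a subobject of an object in `P`. -/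
def Cogenerates : Prop :=
  ∀ X : A, ∃ (Y : A) (i : X ⟶ Y), P Y ∧ Mono i

/-- Every object of `A` is a quotient of an object in `P`. -/
def Generates : Prop :=
  ∀ X : A, ∃ (Y : A) (p : Y ⟶ X), P Y ∧ Epi p

/-- `2`-tilting torsion classes in an abelian category. -/
structure IsTwoTiltingTorsionClass : Prop where
  cogenerates : Cogenerates P
  closedUnderExtensions : P.IsClosedUnderExtensions
  hasKernels : HasKernels P.FullSubcategory
  /-- if `X₁ ⟶ X₂ ⟶ B ⟶ 0` is exact and `X₁`, `X₂` are in `P`, then `B` is in `P` -/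
  prop_of_exact : ∀ (S : ShortComplex A), S.Exact → Epi S.g → P S.X₁ → P S.X₂ → P S.X₃

/-- `2`-cotilting torsion-free classes in an abelian category. -/
structure IsTwoCotiltingTorsionFreeClass : Prop where
  generates : Generates P
  closedUnderExtensions : P.IsClosedUnderExtensions
  hasCokernels : HasCokernels P.FullSubcategory
  /-- if `0 ⟶ A ⟶ X₁ ⟶ X₂` is exact and `X₁`, `X₂` are in `P`, then `A` is in `P` -/
  prop_of_exact : ∀ (S : ShortComplex A), S.Exact → Mono S.f → P S.X₂ → P S.X₃ → P S.X₁

end Classes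

section Pairs

variable {C : Type u} [Category.{v} C] [Preadditive C] [HasZeroObject C] [HasShift C ℤ]
  [∀ n : ℤ, (shiftFunctor C n).Additive] [Pretriangulated C] [IsTriangulated C]

/-- The functor `F` is a triangle equivalence from the derived category of the heart of `t` to the
ambient triangulated category; it extends the inclusion of the heart, and it identifies the natural
t-structure with `t`. -/
structure IsDerivedRealization (t : TStructure C)
    (F : DerivedCategory t.heart.FullSubcategory ⥤ C) [F.CommShift ℤ] : Prop where
  isTriangulated : F.IsTriangulated
  isEquivalence : F.IsEquivalence
  extends_inclusion :
    Nonempty (DerivedCategory.singleFunctor t.heart.FullSubcategory 0 ⋙ F ≅ t.heart.ι)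
  le_iff : ∀ (n : ℤ) (X : DerivedCategory t.heart.FullSubcategory),
    DerivedCategory.TStructure.t.le n X ↔ t.le n (F.obj X)
  ge_iff : ∀ (n : ℤ) (X : DerivedCategory t.heart.FullSubcategory),
    DerivedCategory.TStructure.t.ge n X ↔ t.ge n (F.obj X)

variable (D T : TStructure C)

/-- The intersection of the hearts of `D` and `T`, as a full subcategory of the ambient
triangulated category. -/
abbrev Inter : Type u := (D.heart ⊓ T.heart).FullSubcategory

instance inter_containsZero : (D.heart ⊓ T.heart).ContainsZero where
  exists_zero := ⟨_, isZero_zero C, D.heart.prop_zero, T.heart.prop_zero⟩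

instance inter_isClosedUnderFiniteProducts :
    (D.heart ⊓ T.heart).IsClosedUnderFiniteProducts where
  isClosedUnderLimitsOfShape _ _ :=
    ⟨fun _ ⟨p⟩ ↦ ⟨D.heart.prop_of_isLimit p.isLimit fun j ↦ (p.prop_diag_obj j).1,
      T.heart.prop_of_isLimit p.isLimit fun j ↦ (p.prop_diag_obj j).2⟩⟩

instance inter_hasBinaryBiproducts : HasBinaryBiproducts (Inter D T) :=
  HasBinaryBiproducts.of_hasBinaryProducts

/-- The inclusion of the intersection of the two hearts in the heart of the first t-structure. -/
abbrev interToFst : Inter D T ⥤ D.heart.FullSubcategory := ObjectProperty.ιOfLE inf_le_left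

/-- The inclusion of the intersection of the two hearts in the heart of the second t-structure. -/
abbrev interToSnd : Inter D T ⥤ T.heart.FullSubcategory := ObjectProperty.ιOfLE inf_le_right

instance interToFst_additive : (interToFst D T).Additive where

instance interToSnd_additive : (interToSnd D T).Additive where

/-- Complexes in the intersection of the hearts which are acyclic in the heart of `D`. -/
def acyclicFst : ObjectProperty (HomotopyCategory (Inter D T) (ComplexShape.up ℤ)) :=
  (HomotopyCategory.subcategoryAcyclic D.heart.FullSubcategory).inverseImage
    ((interToFst D T).mapHomotopyCategory (ComplexShape.up ℤ))

/-- Complexes in the intersection of the hearts which are acyclic in the heart of `T`. -/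
def acyclicSnd : ObjectProperty (HomotopyCategory (Inter D T) (ComplexShape.up ℤ)) :=
  (HomotopyCategory.subcategoryAcyclic T.heart.FullSubcategory).inverseImage
    ((interToSnd D T).mapHomotopyCategory (ComplexShape.up ℤ))

/-- The canonical functor from complexes in the intersection of the hearts to the derived category
of the heart of `D`. -/
noncomputable abbrev toDerivedFst :
    HomotopyCategory (Inter D T) (ComplexShape.up ℤ) ⥤
      DerivedCategory D.heart.FullSubcategory :=
  (interToFst D T).mapHomotopyCategory (ComplexShape.up ℤ) ⋙ DerivedCategory.Qh

/-- The canonical functor from complexes in the intersection of the hearts to the derived category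
of the heart of `T`. -/
noncomputable abbrev toDerivedSnd :
    HomotopyCategory (Inter D T) (ComplexShape.up ℤ) ⥤
      DerivedCategory T.heart.FullSubcategory :=
  (interToSnd D T).mapHomotopyCategory (ComplexShape.up ℤ) ⋙ DerivedCategory.Qh

/-- The pair of t-structures `(D, T)` is `n`-tilting. All the usual equivalent forms of the
definition are required: the ambient category is the derived category of both hearts and also the
Verdier quotient of the homotopy category of `E = D.heart ⊓ T.heart` by the complexes acyclic in
one heart, equivalently in the other one (all these identifications being compatible);
`E` cogenerates the heart of `D`, and `E` generates the heart of `T`. -/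
structure IsTiltingPair (n : ℕ) : Prop where
  le_neg_le : D.le (-(n : ℤ)) ≤ T.le 0
  le_zero_le : T.le 0 ≤ D.le 0
  acyclic_eq : acyclicFst D T = acyclicSnd D T
  isLocalization_fst : (toDerivedFst D T).IsLocalization (acyclicFst D T).trW
  isLocalization_snd : (toDerivedSnd D T).IsLocalization (acyclicSnd D T).trW
  exists_realizations : ∃ (F : DerivedCategory D.heart.FullSubcategory ⥤ C)
    (G : DerivedCategory T.heart.FullSubcategory ⥤ C)
    (_ : F.CommShift ℤ) (_ : G.CommShift ℤ),
    IsDerivedRealization D F ∧ IsDerivedRealization T G ∧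
      Nonempty (toDerivedFst D T ⋙ F ≅ toDerivedSnd D T ⋙ G)
  cogenerates : Cogenerates (T.heart.inverseImage D.heart.ι)
  generates : Generates (D.heart.inverseImage T.heart.ι)

end Pairs

section HomotopyCategory

variable (E : Type u) [Category.{v} E] [Preadditive E]

/-- The complexes which are isomorphic in the homotopy category to a complex whose entries in
degrees `> n` are zero. -/
def homotopyLE (n : ℤ) : ObjectProperty (HomotopyCategory E (ComplexShape.up ℤ)) :=
  fun X ↦ ∃ K : CochainComplex E ℤ, K.IsStrictlyLE n ∧
    Nonempty (X ≅ (HomotopyCategory.quotient E (ComplexShape.up ℤ)).obj K)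

/-- The complexes which are isomorphic in the homotopy category to a complex whose entries in
degrees `< n` are zero. -/
def homotopyGE (n : ℤ) : ObjectProperty (HomotopyCategory E (ComplexShape.up ℤ)) :=
  fun X ↦ ∃ K : CochainComplex E ℤ, K.IsStrictlyGE n ∧
    Nonempty (X ≅ (HomotopyCategory.quotient E (ComplexShape.up ℤ)).obj K)

variable {E} [HasZeroObject E] [HasBinaryBiproducts E]

/-- `L` is the left t-structure on the homotopy category of `E`. -/
structure IsLeftTStructure
    (L : TStructure (HomotopyCategory E (ComplexShape.up ℤ))) : Prop where
  le_zero : L.le 0 = homotopyLE E 0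
  ge_zero : L.ge 0 = (homotopyLE E (-1)).rightOrthogonal

/-- `R` is the right t-structure on the homotopy category of `E`. -/
structure IsRightTStructure
    (R : TStructure (HomotopyCategory E (ComplexShape.up ℤ))) : Prop where
  le_zero : R.le 0 = (homotopyGE E 1).leftOrthogonal
  ge_zero : R.ge 0 = homotopyGE E 0

/-- The objects of a heart in the homotopy category of `E` which are isomorphic to an object of `E`
placed in degree `0`. -/
def inHeart (t : TStructure (HomotopyCategory E (ComplexShape.up ℤ))) :
    ObjectProperty t.heart.FullSubcategory :=
  (HomotopyCategory.singleFunctor E 0).essImage.inverseImage t.heart.ι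

/-- The functor which sends an object of `E` to the complex concentrated in degree `0`, with values
in a heart which contains all such complexes. -/
noncomputable abbrev toHeart (t : TStructure (HomotopyCategory E (ComplexShape.up ℤ)))
    (h : ∀ X : E, t.heart ((HomotopyCategory.singleFunctor E 0).obj X)) :
    E ⥤ t.heart.FullSubcategory :=
  t.heart.lift (HomotopyCategory.singleFunctor E 0) h

instance toHeart_additive (t : TStructure (HomotopyCategory E (ComplexShape.up ℤ)))
    (h : ∀ X : E, t.heart ((HomotopyCategory.singleFunctor E 0).obj X)) :
    (toHeart t h).Additive where
  map_add {_ _ _ _} := by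
    ext
    exact (HomotopyCategory.singleFunctor E 0).map_add

end HomotopyCategory

end TiltingPair

open TiltingPair

/-! Kernels give every complex K a truncation ⋯ ⟶ Kⁿ⁻¹ ⟶ ker dⁿ ⟶ 0. Maps from complexes in degrees
≤ n lift to it, uniquely up to homotopy, so the classes K^{≤ n} are the aisles of the left
t-structure L. Dually, cokernels make the classes K^{≥ n} the coaisles of the right t-structure R.
The inclusion of the truncation is an isomorphism below degree n, so a map from K to a complex in
degrees ≤ n - 2 is null-homotopic once its restriction to the truncation is; this is the origin of
the number 2 (`rightTStructure_le_le_leftTStructure_le`). An object of both hearts has one model in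
degrees ≤ 0 and another in degrees ≥ 0, and is then the cokernel of the last differential of the
first model (`essImage_singleFunctor_of_homotopyLE_of_homotopyGE`).

A brutal truncation presents an object X of the left heart as a quotient of an object of E. Each
kernel gains one degree in the coaisles of R; since X starts in R^{≥ -2}, the second kernel lies in
E. Objects of E are projective in this heart because there are no maps from degrees ≥ 0 to degrees ≤
-1. Hence E is exactly the class of projectives, the global dimension is at most 2, and the
cotilting properties follow by dimension shifting. Dually, E is the class of injectives of the right
heart.

In finite global dimension, unbounded complexes of projectives are K-projective and every complex is
obtained from them by finitely many cones, so K(E) is the derived category of the left heart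
(`toDerived_isEquivalence_of_projective`), and dually of the right heart. These equivalences are
t-exact. Their inverses extend the inclusions of the hearts because a fully faithful endofunctor of
the heart fixing the projective generators (or injective cogenerators) is the identity. In
particular a complex in E that is acyclic in either heart is zero in K(E), so the Verdier quotient
of the tilting pair is K(E) itself. -/

namespace TiltingPair

/-! ### K-injective and K-projective complexes in finite global dimension. -/

section KInjective

open CochainComplex HomComplex

variable {A : Type u} [Category.{v} A] [Abelian A]

/-- The short complex `Zⁱ(N) ⟶ Nⁱ ⟶ Zʲ(N)` where `j = i + 1`. -/
noncomputable abbrev cyclesShortComplex (N : CochainComplex A ℤ) (i j : ℤ) : ShortComplex A :=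
  ShortComplex.mk (N.iCycles i) (N.toCycles i j)
    (by rw [← cancel_mono (N.iCycles j)]; simp)

lemma cyclesShortComplex_shortExact {N : CochainComplex A ℤ} (hN : N.Acyclic) (i j : ℤ)
    (hij : i + 1 = j) : (cyclesShortComplex N i j).ShortExact where
  exact := by
    refine ShortComplex.exact_of_f_is_kernel _ (KernelFork.IsLimit.ofι' _ _ fun {W} k hk ↦
      ⟨N.liftCycles k j (by simp [← hij]) ?_, N.liftCycles_i _ _ _ _⟩)
    have hk' : k ≫ N.toCycles i j = 0 := hk
    rw [← N.toCycles_i i j, reassoc_of% hk', zero_comp]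
  mono_f := inferInstanceAs (Mono (N.iCycles i))
  epi_g := by
    have := (N.exactAt_iff_isZero_homology j).1 (hN j)
    exact Preadditive.epi_of_isZero_cokernel' _
      (N.homologyIsCokernel i j (by simp [← hij])) this

/-- Dimension shifting: Zⁱ is the cokernel of Zⁱ⁻¹ ⟶ Nⁱ⁻¹ with Nⁱ⁻¹ injective, so its dimension
bound is one less than that of Zⁱ⁻¹. Starting d places to the left, where the global bound applies,
brings it down to 0. -/
lemma injective_cycles_of_acyclic (d : ℕ) (hA : ∀ X : A, HasInjectiveDimensionLT X (d + 1))
    {N : CochainComplex A ℤ} (hN : N.Acyclic) [∀ i, Injective (N.X i)] (i : ℤ) :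
    Injective (N.cycles i) := by
  suffices ∀ k m : ℕ, m + k = d → ∀ i, HasInjectiveDimensionLT (N.cycles i) (m + 1) by
    have := this d 0 (zero_add d) i
    rwa [injective_iff_hasInjectiveDimensionLT_one]
  intro k
  induction k with
  | zero => rintro m rfl i; exact hA _
  | succ k hk =>
    intro m hm i
    have : Injective (cyclesShortComplex N (i - 1) i).X₂ :=
      inferInstanceAs (Injective (N.X (i - 1)))
    exact (cyclesShortComplex_shortExact hN (i - 1) i (by simp)).hasInjectiveDimensionLT_X₃
      (m + 1) inferInstance (hk (m + 1) (by lia) (i - 1))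

/-- An acyclic complex with injective cycles is contractible. -/
lemma nonempty_homotopy_of_injective_cycles {N : CochainComplex A ℤ} (hN : N.Acyclic)
    (h : ∀ i, Injective (N.cycles i)) : Nonempty (Homotopy (𝟙 N) 0) := by
  have σ : ∀ (i j : ℤ) (hij : i + 1 = j), (cyclesShortComplex N i j).Splitting :=
    fun i j hij ↦
      have : Injective (cyclesShortComplex N i j).X₁ := h i
      (cyclesShortComplex_shortExact hN i j hij).splittingOfInjective
  -- The contraction projects Nᵖ onto its cycles, then lifts them to Nᵖ⁻¹ by the section of Nᵖ⁻¹ ⟶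
  -- Zᵖ.
  refine ⟨(Cochain.equivHomotopy _ _).symm ⟨Cochain.mk (fun p q hpq ↦
    (σ p (p + 1) rfl).r ≫ (σ q p (by lia)).s), ?_⟩⟩
  ext p
  have h₁ := (σ p (p + 1) rfl).id
  have h₂ := (σ (p - 1) p (by lia)).s_g
  have h₃ := (σ (p + 1) (p + 1 + 1) rfl).f_r
  dsimp at h₁ h₂ h₃
  rw [Cochain.add_v, Cochain.ofHom_v, Cochain.ofHom_v, δ_v (-1) 0 (by lia) _ p p (by lia) (p - 1)
    (p + 1) (by lia) rfl]
  simp only [Cochain.mk_v, HomologicalComplex.id_f, HomologicalComplex.zero_f,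
    Int.negOnePow_zero, one_smul, add_zero, Category.assoc]
  rw [← h₁, ← N.toCycles_i (p - 1) p, reassoc_of% h₂, ← N.toCycles_i p (p + 1), Category.assoc,
    reassoc_of% h₃]

/-- The main inductive step: if `0 ⟶ N ⟶ Q ⟶ N' ⟶ 0` is exact with `Q` contractible,
maps from `N` to a complex of injective objects `I` are null-homotopic if maps from `N'`
to `I⟦1⟧` are. -/
lemma nonempty_homotopy_zero_of_shortExact {S : ShortComplex (CochainComplex A ℤ)}
    (hS : S.ShortExact) {I : CochainComplex A ℤ} [∀ i, Injective (I.X i)]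
    (h₂ : ∀ g : S.X₂ ⟶ I, Nonempty (Homotopy g 0))
    (h₃ : ∀ c : S.X₃ ⟶ I⟦(1 : ℤ)⟧, Nonempty (Homotopy c 0)) (f : S.X₁ ⟶ I) :
    Nonempty (Homotopy f 0) := by
  have hSi (i : ℤ) := hS.map_of_exact (HomologicalComplex.eval A (.up ℤ) i)
  have hmono (i : ℤ) : Mono (S.f.f i) := (hSi i).mono_f
  have hepi (i : ℤ) : Epi (S.g.f i) := (hSi i).epi_g
  -- `g` extends `f` in each degree but need not commute with the differentials. Its defect `δ 0 1
  -- g` vanishes on `S.X₁`, so it descends to a 1-cocycle `c` on `S.X₃`. By `h₃`, `c` is the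
  -- coboundary of some `β`, and subtracting `β` corrects `g` to a chain map that still extends `f`.
  let g : Cochain S.X₂ I 0 := Cochain.ofHoms (fun i ↦ Injective.factorThru (f.f i) (S.f.f i))
  have hg : (Cochain.ofHom S.f).comp g (zero_add 0) = Cochain.ofHom f := by
    ext i
    simp [g]
  have hδ : (Cochain.ofHom S.f).comp (δ 0 1 g) (zero_add 1) = 0 := by
    rw [← δ_ofHom_comp, hg, δ_ofHom]
  have hδ' (p q : ℤ) (hpq : p + 1 = q) : S.f.f p ≫ (δ 0 1 g).v p q hpq = 0 := by
    simpa using Cochain.congr_v hδ p q hpq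
  let c : Cochain S.X₃ I 1 := Cochain.mk (fun p q hpq ↦ have := (hSi p).epi_g; (hSi p).exact.desc _ (hδ' p q hpq))
  have hc : (Cochain.ofHom S.g).comp c (zero_add 1) = δ 0 1 g := by
    ext p q hpq
    have := (hSi p).epi_g
    simp only [Cochain.zero_cochain_comp_v, Cochain.ofHom_v, c]
    exact (hSi p).exact.g_desc _ (hδ' p q hpq)
  have hc' : δ 1 2 c = 0 := by
    ext p q hpq
    rw [← cancel_epi (S.g.f p)]
    have : (Cochain.ofHom S.g).comp (δ 1 2 c) (zero_add 2) = 0 := by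
      rw [← δ_ofHom_comp, hc, δ_δ]
    simpa using Cochain.congr_v this p q hpq
  obtain ⟨β, hβ⟩ : ∃ β : Cochain S.X₃ I 0, δ 0 1 β = c := by
    rw [← Cocycle.mk_coe c 2 (by lia) hc', ← mem_coboundaries_iff _ 0 (by lia),
      ← CohomologyClass.toHom_mk_eq_zero_iff, CohomologyClass.toHom_mk]
    obtain ⟨γ⟩ := h₃ (Cocycle.equivHomShift.symm (Cocycle.mk c 2 (by lia) hc'))
    exact (HomotopyCategory.eq_of_homotopy _ _ γ).trans (Functor.map_zero _ _ _)
  let φ : S.X₂ ⟶ I := Cocycle.homOf (Cocycle.mk (g - (Cochain.ofHom S.g).comp β (zero_add 0)) 1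
    (by lia) (by rw [δ_sub, δ_ofHom_comp, hβ, hc, sub_self]))
  have hf : f = S.f ≫ φ := by
    ext i
    have h₁ := Cochain.congr_v hg i i (by lia)
    have h₂ : S.f.f i ≫ S.g.f i = 0 := (S.map (HomologicalComplex.eval A (.up ℤ) i)).zero
    simp only [Cochain.zero_cochain_comp_v, Cochain.ofHom_v] at h₁
    simp [φ, ← h₁, reassoc_of% h₂]
  obtain ⟨γ⟩ := h₂ φ
  exact ⟨(Homotopy.ofEq hf).trans ((γ.compLeft S.f).trans (.ofEq (by simp)))⟩

/-- Any complex embeds in a contractible complex of injective objects. -/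
lemma exists_mono_contractible [EnoughInjectives A] (N : CochainComplex A ℤ) :
    ∃ (Q : CochainComplex A ℤ) (ι : N ⟶ Q), Mono ι ∧ (∀ i, Injective (Q.X i)) ∧
      Nonempty (Homotopy (𝟙 Q) 0) := by
  let ι : N ⟶ mappingCone (𝟙 (cm5b.I N)) := cm5b.i (𝟙 N) ≫ biprod.fst
  have hι (i : ℤ) : Mono (ι.f i) :=
    @mono_of_mono_fac _ _ _ _ _ _ _ _ (Injective.ι_mono (N.X i))
      (Category.assoc _ _ _ |>.trans (cm5b.i_f_comp (𝟙 N) i))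
  exact ⟨_, ι, HomologicalComplex.mono_of_mono_f _ hι, inferInstance,
    ⟨mappingCone.homotopyToZeroOfId _⟩⟩

lemma acyclic_of_homotopy {Q : CochainComplex A ℤ} (γ : Homotopy (𝟙 Q) 0) : Q.Acyclic := by
  intro i
  rw [HomologicalComplex.exactAt_iff_isZero_homology, IsZero.iff_id_eq_zero,
    ← HomologicalComplex.homologyMap_id, γ.homologyMap_eq i, HomologicalComplex.homologyMap_zero]

/-- In an abelian category with enough injectives in which all objects have bounded injective
dimension, any complex of injective objects is K-injective. -/
lemma isKInjective_of_hasInjectiveDimensionLT [EnoughInjectives A] (d : ℕ)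
    (hA : ∀ X : A, HasInjectiveDimensionLT X (d + 1)) (I : CochainComplex A ℤ)
    [∀ i, Injective (I.X i)] : I.IsKInjective where
  nonempty_homotopy_zero {N} f hN := by
    -- Induction on a bound for the injective dimension of the terms of `N`. The complex `I` is
    -- generalized because the inductive step replaces it by its shift. When the terms of `N` are
    -- injective, `N` itself is contractible.
    suffices ∀ (k : ℕ) (N : CochainComplex A ℤ) (_ : N.Acyclic)
        (_ : ∀ i, HasInjectiveDimensionLT (N.X i) (k + 1)) (I : CochainComplex A ℤ)
        (_ : ∀ i, Injective (I.X i)) (f : N ⟶ I), Nonempty (Homotopy f 0) from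
      this d N hN (fun _ ↦ hA _) I inferInstance f
    intro k
    induction k with
    | zero =>
      intro N hN hN' I _ f
      have (i : ℤ) : Injective (N.X i) := by
        rw [injective_iff_hasInjectiveDimensionLT_one]
        exact hN' i
      obtain ⟨h⟩ := nonempty_homotopy_of_injective_cycles hN (injective_cycles_of_acyclic d hA hN)
      exact ⟨(Homotopy.ofEq (by simp)).trans ((h.compRight f).trans (.ofEq (by simp)))⟩
    | succ k hk =>
      intro N hN hN' I _ f
      obtain ⟨Q, ι, _, _, ⟨γ⟩⟩ := exists_mono_contractible N
      have hS : (ShortComplex.mk ι (cokernel.π ι) (cokernel.condition ι)).ShortExact :=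
        { exact := ShortComplex.exact_cokernel ι }
      refine nonempty_homotopy_zero_of_shortExact hS (fun g ↦ ⟨?_⟩) (fun c ↦ ?_) f
      · exact (Homotopy.ofEq (by simp)).trans ((γ.compRight g).trans (.ofEq (by simp)))
      · refine hk _ (hS.acyclic_X₃ ⟨fun i ↦ ?_⟩) (fun i ↦ ?_) (I⟦(1 : ℤ)⟧)
          (fun i ↦ inferInstanceAs (Injective (I.X (i + 1)))) c
        · exact (quasiIsoAt_iff_exactAt _ _ (hN i)).2 (acyclic_of_homotopy γ i)
        · exact (hS.map_of_exact (HomologicalComplex.eval A (.up ℤ) i)).hasInjectiveDimensionLT_X₃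
            (k + 1) (inferInstanceAs (HasInjectiveDimensionLT (Q.X i) (k + 1))) (hN' i)

/-- Dimension shifting along a projective presentation, whose opposite is an injective
copresentation. -/
lemma hasInjectiveDimensionLT_op [EnoughProjectives A] (n : ℕ) :
    ∀ (X : A) (_ : HasProjectiveDimensionLT X n), HasInjectiveDimensionLT (Opposite.op X) n := by
  induction n with
  | zero =>
    intro X _
    rw [hasInjectiveDimensionLT_zero_iff_isZero]
    exact (isZero_of_hasProjectiveDimensionLT_zero X).op
  | succ n hn =>
    intro X hX
    obtain _ | n := n
    · have : Projective X := projective_iff_hasProjectiveDimensionLT_one.2 hX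
      infer_instance
    · have hS : (ShortComplex.mk _ _ (kernel.condition (Projective.π X))).ShortExact :=
        { exact := ShortComplex.exact_kernel _ }
      refine hS.op.hasInjectiveDimensionLT_X₁ (n + 1) (hn _ ?_)
        (inferInstanceAs (HasInjectiveDimensionLT (Opposite.op (Projective.over X)) (n + 1 + 1)))
      exact hS.hasProjectiveDimensionLT_X₁ (n + 1)
        (inferInstanceAs (HasProjectiveDimensionLT (Projective.over X) (n + 1))) hX

/-- In an abelian category with enough projectives in which all objects have bounded projective
dimension, any complex of projective objects is K-projective. -/
lemma isKProjective_of_hasProjectiveDimensionLT [EnoughProjectives A] (d : ℕ)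
    (hA : ∀ X : A, HasProjectiveDimensionLT X (d + 1)) (P : CochainComplex A ℤ)
    [∀ i, Projective (P.X i)] : P.IsKProjective := by
  have (i : ℤ) : Injective (((opEquivalence A).functor.obj (Opposite.op P)).X i) :=
    inferInstanceAs (Injective (Opposite.op (P.X (-i))))
  exact isKProjective_of_op (isKInjective_of_hasInjectiveDimensionLT d
    (fun X ↦ hasInjectiveDimensionLT_op _ X.unop (hA _)) _)

/-- Any complex is a quotient of a contractible complex of projective objects. -/
lemma exists_epi_contractible [EnoughProjectives A] (N : CochainComplex A ℤ) :
    ∃ (Q : CochainComplex A ℤ) (π : Q ⟶ N), Epi π ∧ (∀ i, Projective (Q.X i)) := by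
  obtain ⟨Q, ι, _, _, ⟨γ⟩⟩ := exists_mono_contractible ((opEquivalence A).functor.obj (.op N))
  let e := (opEquivalence A).unitIso.app (.op N)
  let Q' := ((opEquivalence A).inverse.obj Q).unop
  let π : Q' ⟶ N := (e.hom ≫ (opEquivalence A).inverse.map ι).unop
  have h : Mono (e.hom ≫ (opEquivalence A).inverse.map ι) := inferInstance
  refine ⟨Q', π, inferInstance, fun i ↦ ?_⟩
  have : Injective (Q.X (-i)) := inferInstance
  exact inferInstanceAs (Projective (Q.X (-i)).unop)

end KInjective

section

variable {A E : Type*} [Category* A] [Preadditive A] [Category* E] [Preadditive E]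
  (J : E ⥤ A) [J.Additive] [J.Full] [J.Faithful]

/-- A complex whose terms are in the essential image of a fully faithful functor `J`
is isomorphic to the image of a complex. -/
lemma exists_mapHomologicalComplex_iso (K : CochainComplex A ℤ) (hK : ∀ i, J.essImage (K.X i)) :
    ∃ L : CochainComplex E ℤ, Nonempty ((J.mapHomologicalComplex (.up ℤ)).obj L ≅ K) := by
  let L : CochainComplex E ℤ :=
    { X := fun i ↦ (hK i).witness
      d := fun i j ↦ J.preimage ((hK i).getIso.hom ≫ K.d i j ≫ (hK j).getIso.inv)
      shape := fun i j hij ↦ J.map_injective (by simp [K.shape i j hij])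
      d_comp_d' := fun i j k _ _ ↦ J.map_injective (by simp) }
  exact ⟨L, ⟨HomologicalComplex.Hom.isoOfComponents (fun i ↦ (hK i).getIso)
    (fun i j _ ↦ by
      change (hK i).getIso.hom ≫ K.d i j =
        J.map (J.preimage ((hK i).getIso.hom ≫ K.d i j ≫ (hK j).getIso.inv)) ≫ (hK j).getIso.hom
      simp)⟩⟩

end

/-! ### The homotopy category of projectives or injectives as a derived category. -/

section DerivedEquivalence

universe v' u' w

variable {A : Type u} [Category.{v} A] [Abelian A] {E : Type u'} [Category.{v'} E]
  [Preadditive E] (J : E ⥤ A) [J.Additive] [J.Full] [J.Faithful]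

variable [HasDerivedCategory.{w} A]

/-- The canonical functor from the homotopy category of `E` to the derived category of `A`
which is induced by an additive functor `J : E ⥤ A`. -/
noncomputable abbrev toDerived (J : E ⥤ A) [J.Additive] :
    HomotopyCategory E (ComplexShape.up ℤ) ⥤ DerivedCategory A :=
  J.mapHomotopyCategory (ComplexShape.up ℤ) ⋙ DerivedCategory.Qh

lemma toDerived_essImage_Q_obj (K : CochainComplex A ℤ) (hK : ∀ i, J.essImage (K.X i)) :
    (toDerived J).essImage (DerivedCategory.Q.obj K) := by
  obtain ⟨L, ⟨e⟩⟩ := exists_mapHomologicalComplex_iso J K hK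
  exact ⟨(HomotopyCategory.quotient _ _).obj L,
    ⟨(DerivedCategory.quotientCompQhIso A).app _ ≪≫ DerivedCategory.Q.mapIso e⟩⟩

lemma toDerived_fullyFaithful
    (h : ∀ K L : HomotopyCategory E (ComplexShape.up ℤ), Function.Bijective
      (DerivedCategory.Qh.map : ((J.mapHomotopyCategory (ComplexShape.up ℤ)).obj K ⟶
        (J.mapHomotopyCategory (ComplexShape.up ℤ)).obj L) → _)) :
    (toDerived J).Full ∧ (toDerived J).Faithful := by
  refine ⟨⟨fun {K L} f ↦ ?_⟩, ⟨fun {K L} f g hfg ↦ ?_⟩⟩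
  · obtain ⟨g, rfl⟩ := (h K L).2 f
    obtain ⟨g, rfl⟩ := (J.mapHomotopyCategory (ComplexShape.up ℤ)).map_surjective g
    exact ⟨g, rfl⟩
  · exact (J.mapHomotopyCategory (ComplexShape.up ℤ)).map_injective ((h K L).1 hfg)

variable [HasZeroObject E] [HasBinaryBiproducts E]

/-- If `E` identifies to the full subcategory of projective objects in an abelian category with
enough projectives and finite global dimension, then the homotopy category of `E` is equivalent
to the derived category. -/
lemma toDerived_isEquivalence_of_projective (hJ : ∀ X : A, Projective X ↔ J.essImage X)
    [EnoughProjectives A] (d : ℕ) (hA : ∀ X : A, HasProjectiveDimensionLT X (d + 1)) :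
    (toDerived J).IsEquivalence := by
  obtain ⟨_, _⟩ := toDerived_fullyFaithful J (by
    rintro ⟨K⟩ ⟨L⟩
    have (i : ℤ) : Projective (((J.mapHomologicalComplex (.up ℤ)).obj K).X i) :=
      (hJ _).2 (J.obj_mem_essImage _)
    have := isKProjective_of_hasProjectiveDimensionLT d hA
      ((J.mapHomologicalComplex (.up ℤ)).obj K)
    exact CochainComplex.IsKProjective.Qh_map_bijective _ _)
  -- Essential surjectivity by induction on the projective dimension of the terms. An epimorphism
  -- onto K from a complex of projectives has a kernel with smaller bound, and the essential image
  -- of the full triangulated functor `toDerived J` is closed under cones.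
  suffices ∀ (k : ℕ) (K : CochainComplex A ℤ) (_ : ∀ i, HasProjectiveDimensionLT (K.X i) (k + 1)),
      (toDerived J).essImage (DerivedCategory.Q.obj K) by
    have : (toDerived J).EssSurj := ⟨fun X ↦
      Functor.essImage.ofIso (DerivedCategory.Q.objObjPreimageIso X) (this d _ (fun _ ↦ hA _))⟩
    exact { }
  intro k
  induction k with
  | zero =>
    intro K hK
    exact toDerived_essImage_Q_obj J K (fun i ↦ (hJ _).1
      (projective_iff_hasProjectiveDimensionLT_one.2 (hK i)))
  | succ k hk =>
    intro K hK
    obtain ⟨Q, π, _, _⟩ := exists_epi_contractible K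
    have hS : (ShortComplex.mk _ π (kernel.condition π)).ShortExact :=
      { exact := ShortComplex.exact_kernel π }
    refine (toDerived J).essImage.ext_of_isTriangulatedClosed₃ _
      (DerivedCategory.triangleOfSES_distinguished hS) (hk _ fun i ↦ ?_)
      (toDerived_essImage_Q_obj J _ fun i ↦ (hJ _).1 (by dsimp; infer_instance))
    exact (hS.map_of_exact (HomologicalComplex.eval A (.up ℤ) i)).hasProjectiveDimensionLT_X₁
      (k + 1) (inferInstanceAs (HasProjectiveDimensionLT (Q.X i) (k + 1))) (hK i)

/-- If `E` identifies to the full subcategory of injective objects in an abelian category with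
enough injectives and finite global dimension, then the homotopy category of `E` is equivalent
to the derived category. -/
lemma toDerived_isEquivalence_of_injective (hJ : ∀ X : A, Injective X ↔ J.essImage X)
    [EnoughInjectives A] (d : ℕ) (hA : ∀ X : A, HasInjectiveDimensionLT X (d + 1)) :
    (toDerived J).IsEquivalence := by
  obtain ⟨_, _⟩ := toDerived_fullyFaithful J (by
    rintro ⟨K⟩ ⟨L⟩
    have (i : ℤ) : Injective (((J.mapHomologicalComplex (.up ℤ)).obj L).X i) :=
      (hJ _).2 (J.obj_mem_essImage _)
    have := isKInjective_of_hasInjectiveDimensionLT d hA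
      ((J.mapHomologicalComplex (.up ℤ)).obj L)
    exact CochainComplex.IsKInjective.Qh_map_bijective _ _)
  suffices ∀ (k : ℕ) (K : CochainComplex A ℤ) (_ : ∀ i, HasInjectiveDimensionLT (K.X i) (k + 1)),
      (toDerived J).essImage (DerivedCategory.Q.obj K) by
    have : (toDerived J).EssSurj := ⟨fun X ↦
      Functor.essImage.ofIso (DerivedCategory.Q.objObjPreimageIso X) (this d _ (fun _ ↦ hA _))⟩
    exact { }
  intro k
  induction k with
  | zero =>
    intro K hK
    exact toDerived_essImage_Q_obj J K (fun i ↦ (hJ _).1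
      (injective_iff_hasInjectiveDimensionLT_one.2 (hK i)))
  | succ k hk =>
    intro K hK
    obtain ⟨Q, ι, _, _, _⟩ := exists_mono_contractible K
    have hS : (ShortComplex.mk ι _ (cokernel.condition ι)).ShortExact :=
      { exact := ShortComplex.exact_cokernel ι }
    refine (toDerived J).essImage.ext_of_isTriangulatedClosed₁ _
      (DerivedCategory.triangleOfSES_distinguished hS)
      (toDerived_essImage_Q_obj J _ fun i ↦ (hJ _).1 (by dsimp; infer_instance))
      (hk _ fun i ↦ ?_)
    exact (hS.map_of_exact (HomologicalComplex.eval A (.up ℤ) i)).hasInjectiveDimensionLT_X₃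
      (k + 1) (inferInstanceAs (HasInjectiveDimensionLT (Q.X i) (k + 1))) (hK i)

end DerivedEquivalence

/-! ### Truncations of complexes by kernels and cokernels. -/

section Truncation

open CochainComplex HomComplex

variable {E : Type u} [Category.{v} E] [Preadditive E]

/-- The subcomplex of `K` given by the kernels of morphisms `φ i : K.X i ⟶ Y i`. -/
@[simps]
noncomputable def kernelComplex [HasKernels E] (K : CochainComplex E ℤ) {Y : ℤ → E}
    (φ : ∀ i, K.X i ⟶ Y i)
    (h : ∀ i, kernel.ι (φ i) ≫ K.d i (i + 1) ≫ φ (i + 1) = 0) : CochainComplex E ℤ where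
  X i := kernel (φ i)
  d i j := kernel.lift _ (kernel.ι (φ i) ≫ K.d i j) (by
    by_cases hij : i + 1 = j
    · subst hij
      rw [Category.assoc, h]
    · rw [K.shape _ _ hij, comp_zero, zero_comp])
  shape i j hij := by
    rw [← cancel_mono (kernel.ι _), kernel.lift_ι, K.shape _ _ hij, comp_zero, zero_comp]
  d_comp_d' i j k _ _ := by
    rw [← cancel_mono (kernel.ι _)]
    simp

/-- The inclusion of the subcomplex `kernelComplex K φ h`. -/
@[simps]
noncomputable def kernelComplexι [HasKernels E] (K : CochainComplex E ℤ) {Y : ℤ → E}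
    (φ : ∀ i, K.X i ⟶ Y i)
    (h : ∀ i, kernel.ι (φ i) ≫ K.d i (i + 1) ≫ φ (i + 1) = 0) : kernelComplex K φ h ⟶ K where
  f i := kernel.ι (φ i)
  comm' _ _ _ := (kernel.lift_ι _ _ _).symm

/-- The quotient complex of `K` given by the cokernels of morphisms `ψ i : Y i ⟶ K.X i`. -/
@[simps]
noncomputable def cokernelComplex [HasCokernels E] (K : CochainComplex E ℤ) {Y : ℤ → E}
    (ψ : ∀ i, Y i ⟶ K.X i)
    (h : ∀ i, ψ i ≫ K.d i (i + 1) ≫ cokernel.π (ψ (i + 1)) = 0) : CochainComplex E ℤ where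
  X i := cokernel (ψ i)
  d i j := cokernel.desc _ (K.d i j ≫ cokernel.π (ψ j)) (by
    by_cases hij : i + 1 = j
    · subst hij
      rw [h]
    · rw [K.shape _ _ hij, zero_comp, comp_zero])
  shape i j hij := by
    rw [← cancel_epi (cokernel.π _), cokernel.π_desc, K.shape _ _ hij, comp_zero, zero_comp]
  d_comp_d' i j k _ _ := by
    rw [← cancel_epi (cokernel.π _)]
    simp

/-- The projection to the quotient complex `cokernelComplex K ψ h`. -/
@[simps]
noncomputable def cokernelComplexπ [HasCokernels E] (K : CochainComplex E ℤ) {Y : ℤ → E}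
    (ψ : ∀ i, Y i ⟶ K.X i)
    (h : ∀ i, ψ i ≫ K.d i (i + 1) ≫ cokernel.π (ψ (i + 1)) = 0) : K ⟶ cokernelComplex K ψ h where
  f i := cokernel.π (ψ i)
  comm' _ _ _ := cokernel.π_desc _ _ _

/-- A morphism `ι : V ⟶ K` is a left truncation in degrees `≤ n` if it identifies `V` to the
subcomplex `⋯ ⟶ K.X (n - 1) ⟶ ker (K.d n (n + 1)) ⟶ 0` of `K`. -/
structure IsLeftTruncation {V K : CochainComplex E ℤ} (ι : V ⟶ K) (n : ℤ) : Prop where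
  mono (i : ℤ) : Mono (ι.f i)
  isZero (i : ℤ) (hi : n < i) : IsZero (V.X i)
  exists_lift (i : ℤ) (hi : i ≤ n) {W : E} (f : W ⟶ K.X i)
    (hf : i = n → f ≫ K.d i (i + 1) = 0) : ∃ l, l ≫ ι.f i = f

/-- A morphism `π : K ⟶ V` is a right truncation in degrees `≥ n` if it identifies `V` to the
quotient complex `0 ⟶ coker (K.d (n - 1) n) ⟶ K.X (n + 1) ⟶ ⋯` of `K`. -/
structure IsRightTruncation {K V : CochainComplex E ℤ} (π : K ⟶ V) (n : ℤ) : Prop where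
  epi (i : ℤ) : Epi (π.f i)
  isZero (i : ℤ) (hi : i < n) : IsZero (V.X i)
  exists_desc (i : ℤ) (hi : n ≤ i) {W : E} (f : K.X i ⟶ W)
    (hf : i = n → K.d (i - 1) i ≫ f = 0) : ∃ l, π.f i ≫ l = f

lemma exists_isLeftTruncation [HasKernels E] [HasBinaryBiproducts E]
    (K : CochainComplex E ℤ) (n : ℤ) :
    ∃ (V : CochainComplex E ℤ) (ι : V ⟶ K), IsLeftTruncation ι n := by
  -- The kernel of `φ i` is all of `K.X i` for i < n, the kernel of the differential for i = n, and
  -- zero for i > n, so one formula describes the subcomplex in every degree.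
  let φ (i : ℤ) : K.X i ⟶ K.X i ⊞ K.X (i + 1) :=
    biprod.lift (if n < i then 𝟙 _ else 0) (if n ≤ i then K.d i (i + 1) else 0)
  have hφ (i : ℤ) (hi : n ≤ i) : kernel.ι (φ i) ≫ K.d i (i + 1) = 0 := by
    have := kernel.condition (φ i) =≫ biprod.snd
    simpa [φ, hi] using this
  refine ⟨_, kernelComplexι K φ (fun i ↦ ?_), ⟨fun i ↦ ?_, fun i hi ↦ ?_, fun i hi W f hf ↦ ?_⟩⟩
  · by_cases hi : n ≤ i
    · rw [reassoc_of% (hφ i hi), zero_comp]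
    · by_cases hi' : n ≤ i + 1 <;> ext <;> simp [φ, hi', show ¬ n < i + 1 by lia]
  · exact inferInstanceAs (Mono (kernel.ι (φ i)))
  · refine (IsZero.iff_id_eq_zero (kernel (φ i))).2 ?_
    rw [← cancel_mono (kernel.ι (φ i))]
    have := kernel.condition (φ i) =≫ biprod.fst
    simpa [φ, hi] using this
  · refine ⟨kernel.lift _ f ?_, kernel.lift_ι _ _ _⟩
    obtain rfl | hi := hi.eq_or_lt
    · ext <;> simp [φ, hf]
    · ext <;> simp [φ, show ¬ n < i by lia, show ¬ n ≤ i by lia]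

lemma exists_isRightTruncation [HasCokernels E] [HasBinaryBiproducts E]
    (K : CochainComplex E ℤ) (n : ℤ) :
    ∃ (V : CochainComplex E ℤ) (π : K ⟶ V), IsRightTruncation π n := by
  let ψ (i : ℤ) : K.X i ⊞ K.X (i - 1) ⟶ K.X i :=
    biprod.desc (if i < n then 𝟙 _ else 0) (if i ≤ n then K.d (i - 1) i else 0)
  have hψ (i j : ℤ) (hj : j ≤ n) (hij : i + 1 = j) : K.d i j ≫ cokernel.π (ψ j) = 0 := by
    obtain rfl : i = j - 1 := by lia
    have := biprod.inr ≫= cokernel.condition (ψ j)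
    simpa [ψ, hj] using this
  refine ⟨_, cokernelComplexπ K ψ (fun i ↦ ?_), ⟨fun i ↦ ?_, fun i hi ↦ ?_, fun i hi W f hf ↦ ?_⟩⟩
  · by_cases hi : i + 1 ≤ n
    · rw [hψ i _ hi rfl, comp_zero]
    · obtain rfl | hi := (show n ≤ i by lia).eq_or_lt
      · ext <;> simp [ψ]
      · ext <;> simp [ψ, show ¬ i < n by lia, show ¬ i ≤ n by lia]
  · exact inferInstanceAs (Epi (cokernel.π (ψ i)))
  · refine (IsZero.iff_id_eq_zero (cokernel (ψ i))).2 ?_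
    rw [← cancel_epi (cokernel.π (ψ i))]
    have := biprod.inl ≫= cokernel.condition (ψ i)
    simpa [ψ, hi] using this
  · refine ⟨cokernel.desc _ f ?_, cokernel.π_desc _ _ _⟩
    obtain rfl | hi := hi.eq_or_lt
    · ext <;> simp [ψ, hf]
    · ext <;> simp [ψ, show ¬ i < n by lia, show ¬ i ≤ n by lia]

namespace IsLeftTruncation

variable {V K : CochainComplex E ℤ} {ι : V ⟶ K} {n : ℤ} (hι : IsLeftTruncation ι n)

include hι

/-- The homotopy itself lifts to `V`. The only delicate component is Uⁿ⁺¹ ⟶ Kⁿ: as Uⁿ⁺² and Vⁿ⁺¹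
vanish, the homotopy relation in degree n + 1 says that it is killed by the differential. Allowing U
to reach degree n + 1 is what the injectivity condition of `tStructureOfAisle` requires. -/
lemma nonempty_homotopy {U : CochainComplex E ℤ} (g : U ⟶ V)
    (hU : ∀ i, n + 1 < i → IsZero (U.X i)) (γ : Homotopy (g ≫ ι) 0) :
    Nonempty (Homotopy g 0) := by
  have := hι.mono
  obtain ⟨h, hh⟩ := Cochain.equivHomotopy _ _ γ
  rw [Cochain.ofHom_zero, add_zero] at hh
  have H (p q : ℤ) (hpq : p + -1 = q) : ∃ l, l ≫ ι.f q = h.v p q hpq := by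
    by_cases hq : q ≤ n
    · refine hι.exists_lift q hq _ ?_
      rintro rfl
      have := Cochain.congr_v hh p p (add_zero p)
      rw [δ_v (-1) 0 (by lia) _ p p (add_zero p) q (p + 1) (by lia) rfl] at this
      obtain rfl : p = q + 1 := by lia
      simpa [(hU _ (show q + 1 < q + 1 + 1 by lia)).eq_of_tgt (U.d (q + 1) (q + 1 + 1)) 0,
        (hι.isZero (q + 1) (by lia)).eq_of_src (ι.f (q + 1)) 0] using this.symm
    · exact ⟨0, (hU p (by lia)).eq_of_src _ _⟩
  choose l hl using H
  have hl' : (Cochain.mk l).comp (Cochain.ofHom ι) (add_zero (-1)) = h := by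
    ext p q hpq
    simp [hl]
  refine ⟨(Cochain.equivHomotopy _ _).symm ⟨Cochain.mk l, ?_⟩⟩
  rw [Cochain.ofHom_zero, add_zero]
  ext p
  have := Cochain.congr_v (δ_comp_ofHom (Cochain.mk l) ι 0) p p (add_zero p)
  rw [hl', ← hh] at this
  rw [← cancel_mono (ι.f p)]
  simpa using this

lemma exists_lift_hom {U : CochainComplex E ℤ} (f : U ⟶ K)
    (hU : ∀ i, n < i → IsZero (U.X i)) : ∃ g : U ⟶ V, g ≫ ι = f := by
  have := hι.mono
  have H (i : ℤ) : ∃ l, l ≫ ι.f i = f.f i := by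
    by_cases hi : i ≤ n
    · refine hι.exists_lift i hi _ ?_
      rintro rfl
      rw [f.comm, (hU (i + 1) (by lia)).eq_of_tgt (U.d i (i + 1)) 0, zero_comp]
    · exact ⟨0, (hU i (by lia)).eq_of_src _ _⟩
  choose l hl using H
  exact ⟨{ f := l, comm' := fun i j _ ↦ by
            rw [← cancel_mono (ι.f j), Category.assoc, Category.assoc, ← ι.comm,
              reassoc_of% (hl i), f.comm, hl] },
    by ext i; exact hl i⟩

/-- A homotopy has components Vᵖ ⟶ Bᵖ⁻¹, which can be nonzero only for p < n, where `ι` is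
invertible, so it extends to `K`. This fixes the gap of two between `n` and the top degree of `B`.
-/
lemma nonempty_homotopy_of_comp {B : CochainComplex E ℤ} (g : K ⟶ B)
    (hB : ∀ i, n - 2 < i → IsZero (B.X i)) (γ : Homotopy (ι ≫ g) 0) :
    Nonempty (Homotopy g 0) := by
  have := hι.mono
  obtain ⟨h, hh⟩ := Cochain.equivHomotopy _ _ γ
  rw [Cochain.ofHom_zero, add_zero] at hh
  have hiso (p : ℤ) (hp : p < n) : IsIso (ι.f p) := by
    obtain ⟨s, hs⟩ := hι.exists_lift p hp.le (𝟙 _) (by lia)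
    exact ⟨s, by simp [← cancel_mono (ι.f p), hs], hs⟩
  have H (p q : ℤ) (hpq : p + -1 = q) : ∃ l, ι.f p ≫ l = h.v p q hpq := by
    by_cases hp : p < n
    · have := hiso p hp
      exact ⟨inv (ι.f p) ≫ h.v p q hpq, by simp⟩
    · exact ⟨0, (hB q (by lia)).eq_of_tgt _ _⟩
  choose l hl using H
  have hl' : (Cochain.ofHom ι).comp (Cochain.mk l) (zero_add (-1)) = h := by
    ext p q hpq
    simp [hl]
  refine ⟨(Cochain.equivHomotopy _ _).symm ⟨Cochain.mk l, ?_⟩⟩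
  rw [Cochain.ofHom_zero, add_zero]
  ext p
  by_cases hp : p < n
  · have := hiso p hp
    have := Cochain.congr_v (δ_ofHom_comp ι (Cochain.mk l) 0) p p (add_zero p)
    rw [hl', ← hh] at this
    rw [← cancel_epi (ι.f p)]
    simpa using this
  · exact (hB p (by omega)).eq_of_tgt _ _

end IsLeftTruncation

namespace IsRightTruncation

variable {K V : CochainComplex E ℤ} {π : K ⟶ V} {n : ℤ} (hπ : IsRightTruncation π n)

include hπ

lemma nonempty_homotopy {U : CochainComplex E ℤ} (g : V ⟶ U)
    (hU : ∀ i, i < n - 1 → IsZero (U.X i)) (γ : Homotopy (π ≫ g) 0) :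
    Nonempty (Homotopy g 0) := by
  have := hπ.epi
  obtain ⟨h, hh⟩ := Cochain.equivHomotopy _ _ γ
  rw [Cochain.ofHom_zero, add_zero] at hh
  have H (p q : ℤ) (hpq : p + -1 = q) : ∃ l, π.f p ≫ l = h.v p q hpq := by
    by_cases hp : n ≤ p
    · refine hπ.exists_desc p hp _ ?_
      rintro rfl
      obtain rfl : q = p - 1 := by lia
      have := Cochain.congr_v hh (p - 1) (p - 1) (add_zero _)
      rw [δ_v (-1) 0 (by lia) _ (p - 1) (p - 1) (add_zero _) (p - 1 - 1) p (by lia) (by lia)] at this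
      simpa [(hU _ (show p - 1 - 1 < p - 1 by lia)).eq_of_src (U.d (p - 1 - 1) (p - 1)) 0,
        (hπ.isZero (p - 1) (by lia)).eq_of_tgt (π.f (p - 1)) 0] using this.symm
    · exact ⟨0, (hU q (by lia)).eq_of_tgt _ _⟩
  choose l hl using H
  have hl' : (Cochain.ofHom π).comp (Cochain.mk l) (zero_add (-1)) = h := by
    ext p q hpq
    simp [hl]
  refine ⟨(Cochain.equivHomotopy _ _).symm ⟨Cochain.mk l, ?_⟩⟩
  rw [Cochain.ofHom_zero, add_zero]
  ext p
  have := Cochain.congr_v (δ_ofHom_comp π (Cochain.mk l) 0) p p (add_zero p)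
  rw [hl', ← hh] at this
  rw [← cancel_epi (π.f p)]
  simpa using this

lemma exists_desc_hom {U : CochainComplex E ℤ} (f : K ⟶ U)
    (hU : ∀ i, i < n → IsZero (U.X i)) : ∃ g : V ⟶ U, π ≫ g = f := by
  have := hπ.epi
  have H (i : ℤ) : ∃ l, π.f i ≫ l = f.f i := by
    by_cases hi : n ≤ i
    · refine hπ.exists_desc i hi _ ?_
      rintro rfl
      rw [← f.comm, (hU (i - 1) (by lia)).eq_of_src (U.d (i - 1) i) 0, comp_zero]
    · exact ⟨0, (hU i (by lia)).eq_of_tgt _ _⟩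
  choose l hl using H
  exact ⟨{ f := l, comm' := fun i j _ ↦ by
            rw [← cancel_epi (π.f i), reassoc_of% (hl i), f.comm, π.comm_assoc, hl] },
    by ext i; exact hl i⟩

end IsRightTruncation

end Truncation

/-! ### Constructing a t-structure from its aisles or its coaisles. -/

section TStructureMk

variable {C : Type u} [Category.{v} C] [Preadditive C] [HasZeroObject C] [HasShift C ℤ]
  [∀ n : ℤ, (shiftFunctor C n).Additive] [Pretriangulated C]

/-- The t-structure with aisles `P n`, when any object `X` has an approximation `V ⟶ X` with
`V` in `P 0` such that `Hom(U, V) ⟶ Hom(U, X)` is surjective if `U` is in `P 0` and injective if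
`U` is in `P 1`. -/
noncomputable def tStructureOfAisle (P : ℤ → ObjectProperty C)
    [∀ n, (P n).IsClosedUnderIsomorphisms]
    (shift : ∀ (n a n' : ℤ) (_ : a + n' = n) (X : C) (_ : P n X), P n' (X⟦a⟧))
    (mono : ∀ n, P n ≤ P (n + 1))
    (approx : ∀ X : C, ∃ (V : C) (_ : P 0 V) (f : V ⟶ X),
      (∀ (U : C) (_ : P 0 U) (u : U ⟶ X), ∃ w : U ⟶ V, w ≫ f = u) ∧
        ∀ (U : C) (_ : P 1 U) (w : U ⟶ V), w ≫ f = 0 → w = 0) : TStructure C where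
  le := P
  ge n := (P (n - 1)).rightOrthogonal
  le_shift := shift
  ge_shift n a n' h X hX U u hU := by
    let e := (shiftFunctorCompIsoId C a (-a) (add_neg_cancel a)).app X
    have h0 : (shiftFunctor C (-a)).map u ≫ e.hom = 0 :=
      hX _ (shift (n' - 1) (-a) (n - 1) (by lia) U hU)
    exact (shiftFunctor C (-a)).map_injective (by
      rw [← cancel_mono e.hom, Functor.map_zero, zero_comp]; exact h0)
  zero' X Y f hX hY := hY f (by simpa using hX)
  le_zero_le := mono 0
  ge_one_le X hX U u hU := hX u (by simpa using mono (-1) U (by simpa using hU))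
  exists_triangle_zero_one X := by
    obtain ⟨V, hV, f, hs, hi⟩ := approx X
    obtain ⟨Z, g, δ, hT⟩ := distinguished_cocone_triangle f
    refine ⟨V, Z, hV, fun U u hU ↦ ?_, f, g, δ, hT⟩
    replace hU : P 0 U := by simpa using hU
    let e := (shiftFunctorCompIsoId C (1 : ℤ) (-1) (by lia)).app V
    have h0 : (-δ⟦(-1 : ℤ)⟧' ≫ e.hom) ≫ f = 0 :=
      comp_distTriang_mor_zero₁₂ _ (inv_rot_of_distTriang _ hT)
    -- The composite of `u` with `δ`, shifted by -1, is a map to `V` from an object of `P 1` that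
    -- dies in `X`; injectivity makes it zero. Then `u` comes from a map to `X`, which lifts to `V`
    -- and therefore vanishes in the cone `Z`.
    have h1 := hi _ (shift 0 (-1) 1 (by lia) U hU) (u⟦(-1 : ℤ)⟧' ≫ (-δ⟦(-1 : ℤ)⟧' ≫ e.hom))
      (by rw [Category.assoc, h0, comp_zero])
    have h2 : u ≫ δ = 0 := (shiftFunctor C (-1 : ℤ)).map_injective (by
      rw [Functor.map_zero, Functor.map_comp, ← cancel_mono e.hom, zero_comp, Category.assoc]
      simpa only [Preadditive.neg_comp, Preadditive.comp_neg, neg_eq_zero] using h1)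
    obtain ⟨v, rfl⟩ : ∃ v : U ⟶ X, u = v ≫ g := Triangle.coyoneda_exact₃ _ hT u h2
    obtain ⟨w, rfl⟩ := hs U hU v
    rw [Category.assoc, show f ≫ g = 0 from comp_distTriang_mor_zero₁₂ _ hT, comp_zero]

/-- The t-structure with coaisles `P n`, when any object `X` has an approximation `X ⟶ V` with
`V` in `P 1` such that `Hom(V, U) ⟶ Hom(X, U)` is surjective if `U` is in `P 1` and injective if
`U` is in `P 0`. -/
noncomputable def tStructureOfCoaisle (P : ℤ → ObjectProperty C)
    [∀ n, (P n).IsClosedUnderIsomorphisms]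
    (shift : ∀ (n a n' : ℤ) (_ : a + n' = n) (X : C) (_ : P n X), P n' (X⟦a⟧))
    (anti : ∀ n, P (n + 1) ≤ P n)
    (approx : ∀ X : C, ∃ (V : C) (_ : P 1 V) (f : X ⟶ V),
      (∀ (U : C) (_ : P 1 U) (u : X ⟶ U), ∃ w : V ⟶ U, f ≫ w = u) ∧
        ∀ (U : C) (_ : P 0 U) (w : V ⟶ U), f ≫ w = 0 → w = 0) : TStructure C where
  le n := (P (n + 1)).leftOrthogonal
  ge := P
  ge_shift := shift
  le_shift n a n' h X hX U u hU := by
    let e := (shiftFunctorCompIsoId C a (-a) (add_neg_cancel a)).app X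
    have h0 : e.inv ≫ (shiftFunctor C (-a)).map u = 0 :=
      hX _ (shift (n' + 1) (-a) (n + 1) (by lia) U hU)
    exact (shiftFunctor C (-a)).map_injective (by
      rw [← cancel_epi e.inv, Functor.map_zero, comp_zero]; exact h0)
  zero' X Y f hX hY := hX f (by simpa using hY)
  le_zero_le X hX U u hU := hX u (by simpa using anti 1 U (by simpa using hU))
  ge_one_le := anti 0
  exists_triangle_zero_one X := by
    obtain ⟨V, hV, f, hs, hi⟩ := approx X
    obtain ⟨Z, g, δ, hT⟩ := distinguished_cocone_triangle₁ f
    refine ⟨Z, V, fun U u hU ↦ ?_, hV, g, f, δ, hT⟩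
    replace hU : P 1 U := by simpa using hU
    have hT' := rot_of_distTriang _ hT
    -- `U⟦1⟧` lies in `P 0`, the range in which maps out of `V` are detected on `X`.
    have h1 := hi _ (shift 1 1 0 (by lia) U hU) (δ ≫ u⟦(1 : ℤ)⟧') (by
      rw [← Category.assoc, show f ≫ δ = 0 from comp_distTriang_mor_zero₂₃ _ hT, zero_comp])
    obtain ⟨v, hv⟩ : ∃ v : X⟦(1 : ℤ)⟧ ⟶ U⟦(1 : ℤ)⟧, u⟦(1 : ℤ)⟧' = (-g⟦(1 : ℤ)⟧') ≫ v :=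
      Triangle.yoneda_exact₃ _ hT' (u⟦(1 : ℤ)⟧') h1
    obtain ⟨v, rfl⟩ := (shiftFunctor C (1 : ℤ)).map_surjective v
    obtain ⟨w, rfl⟩ := hs U hU v
    refine (shiftFunctor C (1 : ℤ)).map_injective (hv.trans ?_)
    have : (shiftFunctor C (1 : ℤ)).map g ≫ (shiftFunctor C (1 : ℤ)).map f = 0 := by
      rw [← Functor.map_comp, show g ≫ f = 0 from comp_distTriang_mor_zero₁₂ _ hT,
        Functor.map_zero]
    simp [reassoc_of% this]

end TStructureMk

/-! ### The left and right t-structures and brutal truncations. -/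

section HomotopyCategory

variable {E : Type u} [Category.{v} E] [Preadditive E]

local notation "q" => HomotopyCategory.quotient E (ComplexShape.up ℤ)

instance (n : ℤ) : (homotopyLE E n).IsClosedUnderIsomorphisms where
  of_iso := fun e ⟨K, hK, ⟨e'⟩⟩ ↦ ⟨K, hK, ⟨e.symm ≪≫ e'⟩⟩

instance (n : ℤ) : (homotopyGE E n).IsClosedUnderIsomorphisms where
  of_iso := fun e ⟨K, hK, ⟨e'⟩⟩ ↦ ⟨K, hK, ⟨e.symm ≪≫ e'⟩⟩

lemma homotopyLE_shift (n a n' : ℤ) (h : a + n' = n)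
    (X : HomotopyCategory E (ComplexShape.up ℤ)) (hX : homotopyLE E n X) :
    homotopyLE E n' (X⟦a⟧) := by
  obtain ⟨K, hK, ⟨e⟩⟩ := hX
  exact ⟨K⟦a⟧, K.isStrictlyLE_shift n a n' h,
    ⟨(shiftFunctor _ a).mapIso e ≪≫ ((q).commShiftIso a).symm.app K⟩⟩

lemma homotopyGE_shift (n a n' : ℤ) (h : a + n' = n)
    (X : HomotopyCategory E (ComplexShape.up ℤ)) (hX : homotopyGE E n X) :
    homotopyGE E n' (X⟦a⟧) := by
  obtain ⟨K, hK, ⟨e⟩⟩ := hX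
  exact ⟨K⟦a⟧, K.isStrictlyGE_shift n a n' h,
    ⟨(shiftFunctor _ a).mapIso e ≪≫ ((q).commShiftIso a).symm.app K⟩⟩

lemma homotopyLE_monotone : Monotone (homotopyLE E) :=
  fun _ _ h _ ⟨K, _, e⟩ ↦ ⟨K, K.isStrictlyLE_of_le _ _ h, e⟩

lemma homotopyGE_antitone : Antitone (homotopyGE E) :=
  fun _ _ h _ ⟨K, _, e⟩ ↦ ⟨K, K.isStrictlyGE_of_ge _ _ h, e⟩

lemma hom_eq_zero_of_homotopyLE_of_homotopyGE
    {X Y : HomotopyCategory E (ComplexShape.up ℤ)} {a b : ℤ} (hab : a < b)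
    (hX : homotopyLE E a X) (hY : homotopyGE E b Y) (f : X ⟶ Y) : f = 0 := by
  obtain ⟨K, _, ⟨e⟩⟩ := hX
  obtain ⟨L, _, ⟨e'⟩⟩ := hY
  obtain ⟨g, hg⟩ := (q).map_surjective (e.inv ≫ f ≫ e'.hom)
  obtain rfl : g = 0 := by
    ext i
    by_cases hi : i ≤ a
    · exact (L.isZero_of_isStrictlyGE b i (by lia)).eq_of_tgt _ _
    · exact (K.isZero_of_isStrictlyLE a i (by lia)).eq_of_src _ _
  rw [← cancel_epi e.inv, ← cancel_mono e'.hom, Category.assoc, ← hg]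
  simp

lemma hom_eq_zero_of_homotopyGE_of_homotopyLE
    {X Y : HomotopyCategory E (ComplexShape.up ℤ)} {a b : ℤ} (hab : a < b)
    (hX : homotopyGE E b X) (hY : homotopyLE E a Y) (f : X ⟶ Y) : f = 0 := by
  obtain ⟨K, _, ⟨e⟩⟩ := hX
  obtain ⟨L, _, ⟨e'⟩⟩ := hY
  obtain ⟨g, hg⟩ := (q).map_surjective (e.inv ≫ f ≫ e'.hom)
  obtain rfl : g = 0 := by
    ext i
    by_cases hi : i ≤ a
    · exact (K.isZero_of_isStrictlyGE b i (by lia)).eq_of_src _ _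
    · exact (L.isZero_of_isStrictlyLE a i (by lia)).eq_of_tgt _ _
  rw [← cancel_epi e.inv, ← cancel_mono e'.hom, Category.assoc, ← hg]
  simp

lemma nonempty_homotopy_zero_of_quotient_map_eq_zero {K L : CochainComplex E ℤ} (f : K ⟶ L)
    (hf : (q).map f = 0) : Nonempty (Homotopy f 0) :=
  ⟨HomotopyCategory.homotopyOfEq _ _ (by rw [hf, Functor.map_zero])⟩

lemma IsLeftTruncation.exists_comp_quotient_map_eq {V K : CochainComplex E ℤ} {ι : V ⟶ K} {n : ℤ}
    (hι : IsLeftTruncation ι n) {U : HomotopyCategory E (ComplexShape.up ℤ)}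
    (hU : homotopyLE E n U) (u : U ⟶ (q).obj K) : ∃ w : U ⟶ (q).obj V, w ≫ (q).map ι = u := by
  obtain ⟨K', _, ⟨e⟩⟩ := hU
  obtain ⟨g, hg⟩ := (q).map_surjective (e.inv ≫ u)
  obtain ⟨l, rfl⟩ := hι.exists_lift_hom g (fun i hi ↦ K'.isZero_of_isStrictlyLE n i hi)
  exact ⟨e.hom ≫ (q).map l, by rw [Category.assoc, ← Functor.map_comp, hg, e.hom_inv_id_assoc]⟩

lemma IsLeftTruncation.eq_zero_of_comp_quotient_map {V K : CochainComplex E ℤ} {ι : V ⟶ K} {n : ℤ}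
    (hι : IsLeftTruncation ι n) {U : HomotopyCategory E (ComplexShape.up ℤ)}
    (hU : homotopyLE E (n + 1) U) (w : U ⟶ (q).obj V) (hw : w ≫ (q).map ι = 0) : w = 0 := by
  obtain ⟨K', _, ⟨e⟩⟩ := hU
  obtain ⟨g, hg⟩ := (q).map_surjective (e.inv ≫ w)
  obtain ⟨γ⟩ := nonempty_homotopy_zero_of_quotient_map_eq_zero (g ≫ ι) (by
    rw [Functor.map_comp, hg, Category.assoc, hw, comp_zero])
  obtain ⟨γ'⟩ := hι.nonempty_homotopy g (fun i hi ↦ K'.isZero_of_isStrictlyLE (n + 1) i hi) γ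
  rw [← cancel_epi e.inv, ← hg, HomotopyCategory.eq_of_homotopy _ _ γ', Functor.map_zero,
    comp_zero]

lemma IsLeftTruncation.eq_zero_of_quotient_map_comp {V K : CochainComplex E ℤ} {ι : V ⟶ K} {n : ℤ}
    (hι : IsLeftTruncation ι n) {U : HomotopyCategory E (ComplexShape.up ℤ)}
    (hU : homotopyLE E (n - 2) U) (w : (q).obj K ⟶ U) (hw : (q).map ι ≫ w = 0) : w = 0 := by
  obtain ⟨K', _, ⟨e⟩⟩ := hU
  obtain ⟨g, hg⟩ := (q).map_surjective (w ≫ e.hom)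
  obtain ⟨γ⟩ := nonempty_homotopy_zero_of_quotient_map_eq_zero (ι ≫ g) (by
    rw [Functor.map_comp, hg, ← Category.assoc, hw, zero_comp])
  obtain ⟨γ'⟩ := hι.nonempty_homotopy_of_comp g
    (fun i hi ↦ K'.isZero_of_isStrictlyLE (n - 2) i hi) γ
  rw [← cancel_mono e.hom, ← hg, HomotopyCategory.eq_of_homotopy _ _ γ', Functor.map_zero,
    zero_comp]

lemma IsRightTruncation.exists_quotient_map_comp_eq {K V : CochainComplex E ℤ} {π : K ⟶ V} {n : ℤ}
    (hπ : IsRightTruncation π n) {U : HomotopyCategory E (ComplexShape.up ℤ)}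
    (hU : homotopyGE E n U) (u : (q).obj K ⟶ U) : ∃ w : (q).obj V ⟶ U, (q).map π ≫ w = u := by
  obtain ⟨K', _, ⟨e⟩⟩ := hU
  obtain ⟨g, hg⟩ := (q).map_surjective (u ≫ e.hom)
  obtain ⟨l, rfl⟩ := hπ.exists_desc_hom g (fun i hi ↦ K'.isZero_of_isStrictlyGE n i hi)
  exact ⟨(q).map l ≫ e.inv, by rw [← Category.assoc, ← Functor.map_comp, hg, Category.assoc,
    e.hom_inv_id, Category.comp_id]⟩

lemma IsRightTruncation.eq_zero_of_quotient_map_comp {K V : CochainComplex E ℤ} {π : K ⟶ V} {n : ℤ}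
    (hπ : IsRightTruncation π n) {U : HomotopyCategory E (ComplexShape.up ℤ)}
    (hU : homotopyGE E (n - 1) U) (w : (q).obj V ⟶ U) (hw : (q).map π ≫ w = 0) : w = 0 := by
  obtain ⟨K', _, ⟨e⟩⟩ := hU
  obtain ⟨g, hg⟩ := (q).map_surjective (w ≫ e.hom)
  obtain ⟨γ⟩ := nonempty_homotopy_zero_of_quotient_map_eq_zero (π ≫ g) (by
    rw [Functor.map_comp, hg, ← Category.assoc, hw, zero_comp])
  obtain ⟨γ'⟩ := hπ.nonempty_homotopy g (fun i hi ↦ K'.isZero_of_isStrictlyGE (n - 1) i hi) γ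
  rw [← cancel_mono e.hom, ← hg, HomotopyCategory.eq_of_homotopy _ _ γ', Functor.map_zero,
    zero_comp]

variable (E) [HasZeroObject E] [HasBinaryBiproducts E]

/-- The left t-structure on the homotopy category of an additive category with kernels. -/
noncomputable def leftTStructure [HasKernels E] :
    TStructure (HomotopyCategory E (ComplexShape.up ℤ)) :=
  tStructureOfAisle (homotopyLE E) homotopyLE_shift (fun n ↦ homotopyLE_monotone (by lia))
    (fun X ↦ by
      obtain ⟨K, rfl⟩ := HomotopyCategory.quotient_obj_surjective X
      obtain ⟨V, ι, hι⟩ := exists_isLeftTruncation K 0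
      exact ⟨(q).obj V, ⟨V, (V.isStrictlyLE_iff 0).2 hι.isZero, ⟨Iso.refl _⟩⟩, (q).map ι,
        fun U hU u ↦ hι.exists_comp_quotient_map_eq hU u,
        fun U hU w hw ↦ hι.eq_zero_of_comp_quotient_map hU w hw⟩)

/-- The right t-structure on the homotopy category of an additive category with cokernels. -/
noncomputable def rightTStructure [HasCokernels E] :
    TStructure (HomotopyCategory E (ComplexShape.up ℤ)) :=
  tStructureOfCoaisle (homotopyGE E) homotopyGE_shift (fun n ↦ homotopyGE_antitone (by lia))
    (fun X ↦ by
      obtain ⟨K, rfl⟩ := HomotopyCategory.quotient_obj_surjective X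
      obtain ⟨V, π, hπ⟩ := exists_isRightTruncation K 1
      exact ⟨(q).obj V, ⟨V, (V.isStrictlyGE_iff 1).2 hπ.isZero, ⟨Iso.refl _⟩⟩, (q).map π,
        fun U hU u ↦ hπ.exists_quotient_map_comp_eq hU u,
        fun U hU w hw ↦ hπ.eq_zero_of_quotient_map_comp hU w hw⟩)

lemma leftTStructure_isLeftTStructure [HasKernels E] : IsLeftTStructure (leftTStructure E) where
  le_zero := rfl
  ge_zero := rfl

lemma rightTStructure_isRightTStructure [HasCokernels E] :
    IsRightTStructure (rightTStructure E) where
  le_zero := rfl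
  ge_zero := rfl

variable {E}

/-- The splitting of `kernel φ ⟶ X ⟶ cokernel ψ` when `φ` is the identity and `ψ` is zero. -/
noncomputable def splittingOfIdZero {X : E} (φ ψ : X ⟶ X) [HasKernel φ] [HasCokernel ψ]
    (w : kernel.ι φ ≫ cokernel.π ψ = 0) (hφ : φ = 𝟙 X) (hψ : ψ = 0) :
    (ShortComplex.mk _ _ w).Splitting :=
  have hk : kernel.ι φ = 0 := by simpa [hφ] using kernel.condition φ
  { r := 0
    s := cokernel.desc ψ (𝟙 _) ((Category.comp_id _).trans hψ)
    f_r := by simp [← cancel_mono (kernel.ι φ), hk]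
    s_g := by simp [← cancel_epi (cokernel.π ψ)]
    id := by simp }

/-- The splitting of `kernel φ ⟶ X ⟶ cokernel ψ` when `φ` is zero and `ψ` is the identity. -/
noncomputable def splittingOfZeroId {X : E} (φ ψ : X ⟶ X) [HasKernel φ] [HasCokernel ψ]
    (w : kernel.ι φ ≫ cokernel.π ψ = 0) (hφ : φ = 0) (hψ : ψ = 𝟙 X) :
    (ShortComplex.mk _ _ w).Splitting :=
  have hc : cokernel.π ψ = 0 := by simpa [hψ] using cokernel.condition ψ
  { r := kernel.lift φ (𝟙 _) ((Category.id_comp _).trans hφ)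
    s := 0
    f_r := by simp [← cancel_mono (kernel.ι φ)]
    s_g := by simp [← cancel_epi (cokernel.π ψ), hc]
    id := by simp }

/-- Brutal truncations of complexes give triangles in the homotopy category. -/
lemma exists_distinguished_triangle_homotopyGE_homotopyLE [HasKernels E] [HasCokernels E]
    (X : HomotopyCategory E (ComplexShape.up ℤ)) (n m : ℤ) (h : n + 1 = m) :
    ∃ (A B : HomotopyCategory E (ComplexShape.up ℤ)) (_ : homotopyGE E m A)
      (_ : homotopyLE E n B) (f : A ⟶ X) (g : X ⟶ B) (δ : B ⟶ A⟦(1 : ℤ)⟧),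
      Triangle.mk f g δ ∈ distTriang _ := by
  obtain ⟨K, rfl⟩ := HomotopyCategory.quotient_obj_surjective X
  -- Brutal truncation through `kernelComplex` and `cokernelComplex`: kernels of identities and
  -- cokernels of identities vanish, those of zero maps are the whole term. The resulting sequence
  -- is split in each degree, hence gives a triangle.
  let φ (i : ℤ) : K.X i ⟶ K.X i := if i ≤ n then 𝟙 _ else 0
  let ψ (i : ℤ) : K.X i ⟶ K.X i := if i ≤ n then 0 else 𝟙 _
  have hφ₁ (i : ℤ) (hi : i ≤ n) : φ i = 𝟙 _ := if_pos hi
  have hφ₂ (i : ℤ) (hi : ¬ i ≤ n) : φ i = 0 := if_neg hi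
  have hψ₁ (i : ℤ) (hi : i ≤ n) : ψ i = 0 := if_pos hi
  have hψ₂ (i : ℤ) (hi : ¬ i ≤ n) : ψ i = 𝟙 _ := if_neg hi
  have hk (i : ℤ) (hi : i ≤ n) : kernel.ι (φ i) = 0 := by
    simpa [hφ₁ i hi] using kernel.condition (φ i)
  have hc (i : ℤ) (hi : ¬ i ≤ n) : cokernel.π (ψ i) = 0 := by
    simpa [hψ₂ i hi] using cokernel.condition (ψ i)
  let ι := kernelComplexι K φ (fun i ↦ by
    by_cases hi : i ≤ n
    · rw [hk i hi, zero_comp]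
    · rw [hφ₂ (i + 1) (by lia), comp_zero, comp_zero])
  let π := cokernelComplexπ K ψ (fun i ↦ by
    by_cases hi : i ≤ n
    · rw [hψ₁ i hi, zero_comp]
    · rw [hc (i + 1) (by lia), comp_zero, comp_zero])
  let S : ShortComplex (CochainComplex E ℤ) := ShortComplex.mk ι π (by
    ext i
    by_cases hi : i ≤ n
    · change kernel.ι (φ i) ≫ _ = 0
      rw [hk i hi, zero_comp]
    · change _ ≫ cokernel.π (ψ i) = 0
      rw [hc i hi, comp_zero])
  have σ (i : ℤ) : (S.map (HomologicalComplex.eval E _ i)).Splitting := by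
    by_cases hi : i ≤ n
    · exact splittingOfIdZero (φ i) (ψ i) _ (hφ₁ i hi) (hψ₁ i hi)
    · exact splittingOfZeroId (φ i) (ψ i) _ (hφ₂ i hi) (hψ₂ i hi)
  refine ⟨(q).obj S.X₁, (q).obj S.X₃, ⟨_, ?_, ⟨Iso.refl _⟩⟩, ⟨_, ?_, ⟨Iso.refl _⟩⟩, _, _, _,
    (HomotopyCategory.distinguished_iff_iso_trianglehOfDegreewiseSplit _).2
      ⟨S, σ, ⟨Iso.refl (CochainComplex.trianglehOfDegreewiseSplit S σ)⟩⟩⟩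
  · rw [CochainComplex.isStrictlyGE_iff]
    intro i hi
    refine (IsZero.iff_id_eq_zero (kernel (φ i))).2 ?_
    rw [← cancel_mono (kernel.ι (φ i)), hk i (by lia), comp_zero, comp_zero]
  · rw [CochainComplex.isStrictlyLE_iff]
    intro i hi
    refine (IsZero.iff_id_eq_zero (cokernel (ψ i))).2 ?_
    rw [← cancel_epi (cokernel.π (ψ i)), hc i (by lia), zero_comp, zero_comp]

end HomotopyCategory

/-! ### Comparison of the two t-structures and the intersection of their hearts. -/

section

variable {E : Type u} [Category.{v} E] [Preadditive E] [HasZeroObject E]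

local notation "q" => HomotopyCategory.quotient E (ComplexShape.up ℤ)

lemma homotopyLE_singleFunctor_obj (X : E) (n : ℤ) :
    homotopyLE E n ((HomotopyCategory.singleFunctor E n).obj X) := by
  refine ⟨(CochainComplex.singleFunctor E n).obj X, ?_, ⟨Iso.refl _⟩⟩
  rw [CochainComplex.isStrictlyLE_iff]
  exact fun i hi ↦ HomologicalComplex.isZero_single_obj_X _ _ _ _ (by lia)

lemma homotopyGE_singleFunctor_obj (X : E) (n : ℤ) :
    homotopyGE E n ((HomotopyCategory.singleFunctor E n).obj X) := by
  refine ⟨(CochainComplex.singleFunctor E n).obj X, ?_, ⟨Iso.refl _⟩⟩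
  rw [CochainComplex.isStrictlyGE_iff]
  exact fun i hi ↦ HomologicalComplex.isZero_single_obj_X _ _ _ _ (by lia)

/-- Let f : A ⟶ B and g : B ⟶ A be inverse homotopy equivalences, A in degrees ≤ 0 and B in degrees
≥ 0. Since B⁻¹ = 0, f factors through the cokernel M of A⁻¹ ⟶ A⁰, as `a ≫ b`. The homotopy from f ≫
g to the identity lands in the image of that differential in degree 0, so it dies in M and `b ≫ g ≫
a` is strictly the identity. Thus A is homotopy equivalent to M, and no splitting of idempotents is
needed. -/
lemma essImage_singleFunctor_of_homotopyLE_of_homotopyGE [HasCokernels E]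
    {X : HomotopyCategory E (ComplexShape.up ℤ)} (h₁ : homotopyLE E 0 X)
    (h₂ : homotopyGE E 0 X) : (HomotopyCategory.singleFunctor E 0).essImage X := by
  obtain ⟨A, _, ⟨e⟩⟩ := h₁
  obtain ⟨B, _, ⟨e'⟩⟩ := h₂
  obtain ⟨f, hf⟩ := (q).map_surjective (e.inv ≫ e'.hom)
  obtain ⟨g, hg⟩ := (q).map_surjective (e'.inv ≫ e.hom)
  have hfg : (q).map (f ≫ g) = 𝟙 _ := by simp [hf, hg]
  let γ := HomotopyCategory.homotopyOfEq (f ≫ g) (𝟙 A) (hfg.trans ((q).map_id A).symm)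
  have hd (i : ℤ) : A.d 0 i = 0 := by
    by_cases hi : 0 + 1 = i
    · exact (A.isZero_of_isStrictlyLE 0 i (by lia)).eq_of_tgt _ _
    · exact A.shape _ _ hi
  have hγ : f.f 0 ≫ g.f 0 = γ.hom 0 (-1) ≫ A.d (-1) 0 + 𝟙 _ := by
    have := γ.comm 0
    rw [dNext_eq _ (show (ComplexShape.up ℤ).Rel 0 1 by simp),
      prevD_eq _ (show (ComplexShape.up ℤ).Rel (-1) 0 by simp), hd, zero_comp, zero_add] at this
    exact this
  let π := cokernel.π (A.d (-1) 0)
  let φ : cokernel (A.d (-1) 0) ⟶ B.X 0 := cokernel.desc _ (f.f 0) (by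
    rw [← f.comm, (B.isZero_of_isStrictlyGE 0 (-1) (by lia)).eq_of_src (B.d (-1) 0) 0, comp_zero])
  have hφ : π ≫ φ = f.f 0 := cokernel.π_desc _ _ _
  have hφg : φ ≫ g.f 0 ≫ π = 𝟙 _ := by
    rw [← cancel_epi π, reassoc_of% hφ, reassoc_of% hγ]
    simp [π]
  let M : CochainComplex E ℤ := (HomologicalComplex.single E _ 0).obj (cokernel (A.d (-1) 0))
  let a : A ⟶ M :=
    HomologicalComplex.mkHomToSingle π (fun i hi ↦ by
      obtain rfl : i = -1 := by simp at hi; lia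
      exact cokernel.condition _)
  let b : M ⟶ B :=
    HomologicalComplex.mkHomFromSingle φ (fun i hi ↦ by
      rw [← cancel_epi π, reassoc_of% hφ, f.comm, hd, zero_comp, comp_zero])
  have hab : a ≫ b = f := by
    ext i
    by_cases hi : i = 0
    · subst hi
      simp [a, b, hφ]
    · by_cases hi' : i ≤ 0
      · exact (B.isZero_of_isStrictlyGE 0 i (by lia)).eq_of_tgt _ _
      · exact (A.isZero_of_isStrictlyLE 0 i (by lia)).eq_of_src _ _
  have hba : b ≫ g ≫ a = 𝟙 _ := by
    refine HomologicalComplex.from_single_hom_ext ?_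
    simp [a, b, reassoc_of% hφg, M]
  let e'' : (q).obj A ≅ (q).obj M :=
    { hom := (q).map a
      inv := (q).map (b ≫ g)
      hom_inv_id := by rw [← Functor.map_comp, ← Category.assoc, hab, hfg]
      inv_hom_id := by rw [← Functor.map_comp, Category.assoc, hba]; exact (q).map_id _ }
  exact ⟨cokernel (A.d (-1) 0), ⟨(e ≪≫ e'').symm⟩⟩

variable (E) in
lemma singleFunctor_full : (HomotopyCategory.singleFunctor E 0).Full :=
  inferInstanceAs (CochainComplex.singleFunctor E 0 ⋙ q).Full

variable (E) in
lemma singleFunctor_faithful : (HomotopyCategory.singleFunctor E 0).Faithful where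
  map_injective {X Y f g} h := by
    refine (CochainComplex.singleFunctor E 0).map_injective ?_
    let γ := HomotopyCategory.homotopyOfEq ((CochainComplex.singleFunctor E 0).map f)
      ((CochainComplex.singleFunctor E 0).map g) h
    refine HomologicalComplex.from_single_hom_ext ?_
    refine (γ.comm 0).trans ?_
    rw [dNext_eq _ (show (ComplexShape.up ℤ).Rel 0 1 by simp),
      prevD_eq _ (show (ComplexShape.up ℤ).Rel (-1) 0 by simp)]
    simp

variable [HasBinaryBiproducts E]

/-- Take Y in the left coaisle ≥ n + 1. The inclusion of its truncation in degrees ≤ n is zero in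
K(E), so Y has no nonzero map to its brutal quotient in degrees ≤ m = n - 2. A map X ⟶ Y then
factors through the brutal subcomplex in degrees ≥ m + 1, to which X has no nonzero map. -/
lemma rightTStructure_le_le_leftTStructure_le [HasKernels E] [HasCokernels E]
    (n m : ℤ) (h : m + 2 = n) : (rightTStructure E).le m ≤ (leftTStructure E).le n := by
  intro X hX
  suffices (leftTStructure E).IsLE X n from this.le
  rw [TStructure.isLE_iff_orthogonal _ n (n + 1) rfl]
  intro Y f hY
  replace hX : (homotopyGE E (m + 1)).leftOrthogonal X := hX
  replace hY : (homotopyLE E (n + 1 - 1)).rightOrthogonal Y := hY.ge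
  rw [add_sub_cancel_right] at hY
  obtain ⟨K, rfl⟩ := HomotopyCategory.quotient_obj_surjective Y
  obtain ⟨V, ι, hι⟩ := exists_isLeftTruncation K n
  have hι₀ : (q).map ι = 0 := hY _ ⟨V, (V.isStrictlyLE_iff n).2 hι.isZero, ⟨Iso.refl _⟩⟩
  obtain ⟨A, B, hA, hB, a, b, δ, hT⟩ :=
    exists_distinguished_triangle_homotopyGE_homotopyLE ((q).obj K) m (m + 1) rfl
  have hb : b = 0 := hι.eq_zero_of_quotient_map_comp (by rwa [← h, add_sub_cancel_right]) b
    (by rw [hι₀, zero_comp])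
  obtain ⟨c, rfl⟩ : ∃ c : X ⟶ A, f = c ≫ a :=
    Triangle.coyoneda_exact₂ _ hT f ((congrArg (f ≫ ·) hb).trans comp_zero)
  rw [hX c hA, zero_comp]

lemma leftTStructure_le_le_rightTStructure_le [HasKernels E] [HasCokernels E] (n : ℤ) :
    (leftTStructure E).le n ≤ (rightTStructure E).le n :=
  fun _ hX _ f hY ↦ hom_eq_zero_of_homotopyLE_of_homotopyGE (lt_add_one n) hX hY f

lemma rightTStructure_ge_le_leftTStructure_ge [HasKernels E] [HasCokernels E] (n : ℤ) :
    (rightTStructure E).ge n ≤ (leftTStructure E).ge n :=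
  fun _ hX _ f hY ↦ hom_eq_zero_of_homotopyLE_of_homotopyGE (sub_one_lt n) hY hX f

lemma leftTStructure_ge_le_rightTStructure_ge [HasKernels E] [HasCokernels E]
    (n m : ℤ) (h : m + 2 = n) : (leftTStructure E).ge n ≤ (rightTStructure E).ge m := by
  intro X hX
  suffices (rightTStructure E).IsGE X m from this.ge
  rw [TStructure.isGE_iff_orthogonal _ (m - 1) m (by lia)]
  intro Y f hY
  have := rightTStructure_le_le_leftTStructure_le (n - 1) (m - 1) (by lia) _ hY.le
  exact hX f this

lemma heart_inf_heart_eq_essImage [HasKernels E] [HasCokernels E] :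
    (rightTStructure E).heart ⊓ (leftTStructure E).heart =
      (HomotopyCategory.singleFunctor E 0).essImage := by
  ext X
  constructor
  · rintro ⟨h₁, h₂⟩
    exact essImage_singleFunctor_of_homotopyLE_of_homotopyGE
      ((TStructure.mem_heart_iff _ _).1 h₂).1.le ((TStructure.mem_heart_iff _ _).1 h₁).2.ge
  · rintro ⟨Y, ⟨e⟩⟩
    refine ObjectProperty.prop_of_iso _ e ?_
    have h₁ := homotopyLE_singleFunctor_obj Y 0
    have h₂ := homotopyGE_singleFunctor_obj Y 0
    exact ⟨(TStructure.mem_heart_iff _ _).2 ⟨⟨leftTStructure_le_le_rightTStructure_le _ _ h₁⟩, ⟨h₂⟩⟩,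
      (TStructure.mem_heart_iff _ _).2 ⟨⟨h₁⟩, ⟨rightTStructure_ge_le_leftTStructure_ge _ _ h₂⟩⟩⟩

end

/-! ### Short exact sequences, projectives and injectives in a heart. -/

section Heart

variable {C : Type u} [Category.{v} C] [Preadditive C] [HasZeroObject C] [HasShift C ℤ]
  [∀ n : ℤ, (shiftFunctor C n).Additive] [Pretriangulated C] [IsTriangulated C]
  (t : TStructure C)

lemma heart_shortExact {X₁ X₂ X₃ : t.heart.FullSubcategory} (f : X₁ ⟶ X₂) (g : X₂ ⟶ X₃)
    (δ : X₃.obj ⟶ X₁.obj⟦(1 : ℤ)⟧) (hT : Triangle.mk f.hom g.hom δ ∈ distTriang C) :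
    ∃ w : f ≫ g = 0, (ShortComplex.mk f g w).ShortExact := by
  have h₁ := AbelianSubcategory.isLimitKernelForkOfDistTriang (ι := t.heart.ι)
    (heart_hom_shift_eq_zero t) f g δ hT
  have h₂ := AbelianSubcategory.isColimitCokernelCoforkOfDistTriang (ι := t.heart.ι)
    (heart_hom_shift_eq_zero t) f g δ hT
  exact ⟨t.heart.ι.map_injective (comp_distTriang_mor_zero₁₂ _ hT), .mk' (ShortComplex.exact_of_f_is_kernel _ h₁) (mono_of_isLimit_fork h₁)
    (epi_of_isColimit_cofork h₂)⟩

lemma heart_exists_distinguished_triangle {S : ShortComplex t.heart.FullSubcategory}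
    (hS : S.ShortExact) :
    ∃ δ : S.X₃.obj ⟶ S.X₁.obj⟦(1 : ℤ)⟧, Triangle.mk S.f.hom S.g.hom δ ∈ distTriang C := by
  have := hS.epi_g
  obtain ⟨K, i, δ, hT⟩ := AbelianSubcategory.exists_distinguished_triangle_of_epi
    (heart_hom_shift_eq_zero t) (heart_admissibleMorphism t) S.g
  have h := AbelianSubcategory.isLimitKernelForkOfDistTriang (ι := t.heart.ι)
    (heart_hom_shift_eq_zero t) i S.g δ hT
  let e : S.X₁ ≅ K := IsLimit.conePointUniqueUpToIso hS.fIsKernel h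
  have he : e.hom ≫ i = S.f := IsLimit.conePointUniqueUpToIso_hom_comp hS.fIsKernel h
    WalkingParallelPair.zero
  refine ⟨δ ≫ (t.heart.ι.map e.inv)⟦(1 : ℤ)⟧', isomorphic_distinguished _ hT _ ?_⟩
  have h₃ : (t.heart.ι.map e.inv)⟦(1 : ℤ)⟧' ≫ (t.heart.ι.map e.hom)⟦(1 : ℤ)⟧' = 𝟙 _ := by
    rw [← Functor.map_comp, ← Functor.map_comp, e.inv_hom_id, CategoryTheory.Functor.map_id,
      CategoryTheory.Functor.map_id]
  exact Triangle.isoMk _ _ (t.heart.ι.mapIso e) (Iso.refl _) (Iso.refl _)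
    ((Category.comp_id _).trans (t.heart.ι.congr_map he).symm)
    ((Category.comp_id _).trans (Category.id_comp _).symm)
    (((Category.assoc _ _ _).trans ((congrArg (δ ≫ ·) h₃).trans (Category.comp_id _))).trans
      (Category.id_comp _).symm)

/-- The obstruction to lifting along an epimorphism with kernel K is a map from P to K⟦1⟧, which
lies in `t.le (-1)`. -/
lemma heart_projective (P : t.heart.FullSubcategory)
    (hP : ∀ (Y : C) (_ : t.le (-1) Y) (f : P.obj ⟶ Y), f = 0) : Projective P where
  factors {X Y} f e _ := by
    obtain ⟨K, i, δ, hT⟩ := AbelianSubcategory.exists_distinguished_triangle_of_epi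
      (heart_hom_shift_eq_zero t) (heart_admissibleMorphism t) e
    obtain ⟨g, hg⟩ : ∃ g : P.obj ⟶ X.obj, f.hom = g ≫ e.hom :=
      Triangle.coyoneda_exact₃ _ hT f.hom
        (hP _ (t.le_shift 0 1 (-1) (by lia) _ ((t.mem_heart_iff _).1 K.property).1.le) _)
    exact ⟨ObjectProperty.homMk g, by ext; exact hg.symm⟩

/-- The obstruction to extending along a monomorphism with cokernel Q is a map from Q⟦-1⟧, which
lies in `t.ge 1`, to I. -/
lemma heart_injective (I : t.heart.FullSubcategory)
    (hI : ∀ (Y : C) (_ : t.ge 1 Y) (f : Y ⟶ I.obj), f = 0) : Injective I where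
  factors {X Y} f e _ := by
    obtain ⟨δ, hT⟩ := heart_exists_distinguished_triangle t
      (S := ShortComplex.mk e (cokernel.π e) (cokernel.condition e))
      { exact := ShortComplex.exact_cokernel e }
    obtain ⟨g, hg⟩ : ∃ g : Y.obj ⟶ I.obj, f.hom = e.hom ≫ g :=
      Triangle.yoneda_exact₂ _ (inv_rot_of_distTriang _ hT) f.hom
        (hI _ (t.ge_shift 0 (-1) 1 (by lia) _
          ((t.mem_heart_iff _).1 (cokernel e).property).2.ge) _)
    exact ⟨ObjectProperty.homMk g, by ext; exact hg.symm⟩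

end Heart

/-! ### Resolutions of length two, tilting and cotilting classes. -/

section Abelian

variable {A : Type u} [Category.{v} A] [Abelian A] (P : ObjectProperty A)

/-- The chain complex `⋯ ⟶ Z ⟶ Z ⟶ P₂ ⟶ P₁ ⟶ P₀` which has zero differentials in
degrees `> 2`. -/
noncomputable def threeTermComplex {P₀ P₁ P₂ : A} (d₀ : P₁ ⟶ P₀) (d₁ : P₂ ⟶ P₁)
    (w : d₁ ≫ d₀ = 0) (Z : A) : ChainComplex A ℕ :=
  ChainComplex.mk P₀ P₁ P₂ d₀ d₁ w (fun _ ↦ ⟨Z, 0, zero_comp⟩)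

/-- The two short exact sequences are spliced at K. The zero object Z fills the degrees above 2; it
is a parameter so that membership in `P` can be assumed for it. -/
lemma exists_projectiveResolution_of_shortExact
    {X K P₀ P₁ P₂ Z : A} {i : K ⟶ P₀} {p : P₀ ⟶ X} {w : i ≫ p = 0} {j : P₂ ⟶ P₁} {s : P₁ ⟶ K}
    {w' : j ≫ s = 0} (hS : (ShortComplex.mk i p w).ShortExact)
    (hT : (ShortComplex.mk j s w').ShortExact) (hZ : IsZero Z)
    [Projective P₀] [Projective P₁] [Projective P₂] (h₀ : P P₀) (h₁ : P P₁)
    (h₂ : P P₂) (h₃ : P Z) :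
    ∃ R : ProjectiveResolution X, (∀ i, P (R.complex.X i)) ∧ ∀ i, 2 < i →
      IsZero (R.complex.X i) := by
  have : Mono i := hS.mono_f
  have : Epi p := hS.epi_g
  have : Mono j := hT.mono_f
  have : Epi s := hT.epi_g
  have hw : j ≫ s ≫ i = 0 := by rw [reassoc_of% w', zero_comp]
  have hw' : (s ≫ i) ≫ p = 0 := by rw [Category.assoc, w, comp_zero]
  have h₀₁ : (ShortComplex.mk (s ≫ i) p hw').Exact :=
    (ShortComplex.exact_iff_of_epi_of_isIso_of_mono
      (S₁ := ShortComplex.mk (s ≫ i) p hw') (S₂ := ShortComplex.mk i p w)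
      { τ₁ := s, τ₂ := 𝟙 _, τ₃ := 𝟙 _ }).2 hS.exact
  have h₁₂ : (ShortComplex.mk j (s ≫ i) hw).Exact :=
    (ShortComplex.exact_iff_of_epi_of_isIso_of_mono
      (S₁ := ShortComplex.mk j s w') (S₂ := ShortComplex.mk j (s ≫ i) hw)
      { τ₁ := 𝟙 _, τ₂ := 𝟙 _, τ₃ := i }).1 hT.exact
  let R := threeTermComplex (s ≫ i) j hw Z
  have h10 : R.d 1 0 = s ≫ i := ChainComplex.mk_d_1_0 _ _ _ _ _ _ _
  have h21 : R.d 2 1 = j := ChainComplex.mk_d_2_1 _ _ _ _ _ _ _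
  have hR (n : ℕ) : R.ExactAt (n + 1) := by
    rw [HomologicalComplex.exactAt_iff' _ (n + 1 + 1) (n + 1) n (by simp) (by simp)]
    match n with
    | 0 =>
      exact (ShortComplex.exact_iff_of_iso (S₁ := R.sc' 2 1 0)
        (S₂ := ShortComplex.mk j (s ≫ i) hw)
        (ShortComplex.isoMk (Iso.refl _) (Iso.refl _) (Iso.refl _)
          ((Category.id_comp _).trans (h21.symm.trans (Category.comp_id _).symm))
          ((Category.id_comp _).trans (h10.symm.trans (Category.comp_id _).symm)))).2 h₁₂
    | 1 =>
      refine (ShortComplex.exact_iff_mono (R.sc' 3 2 1) (hZ.eq_of_src _ _)).2 ?_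
      change Mono (R.d 2 1)
      rwa [h21]
    | n + 2 => exact ShortComplex.exact_of_isZero_X₂ _ hZ
  have hP (n : ℕ) : Projective (R.X n) := by
    obtain (_ | _ | _ | n) := n
    · exact inferInstanceAs (Projective P₀)
    · exact inferInstanceAs (Projective P₁)
    · exact inferInstanceAs (Projective P₂)
    · exact hZ.projective
  have h10' : R.d 1 0 ≫ p = 0 := (congrArg (· ≫ p) h10).trans hw'
  refine ⟨{ complex := R
            π := (ChainComplex.toSingle₀Equiv _ _).symm ⟨p, h10'⟩
            quasiIso := ⟨fun n ↦ ?_⟩ }, fun n ↦ ?_, fun n hn ↦ ?_⟩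
  · cases n
    · rw [ChainComplex.quasiIsoAt₀_iff, ShortComplex.quasiIso_iff_of_zeros']
      · refine (ShortComplex.exact_and_epi_g_iff_of_iso
          (S₂ := ShortComplex.mk (s ≫ i) p hw') ?_).2 ⟨h₀₁, ‹_›⟩
        exact ShortComplex.isoMk (Iso.refl _) (Iso.refl _) (Iso.refl _)
          ((Category.id_comp _).trans (h10.symm.trans (Category.comp_id _).symm)) (by
            refine (Category.id_comp _).trans (Eq.trans ?_ (Category.comp_id _).symm)
            exact (ChainComplex.toSingle₀Equiv_symm_apply_f_zero (C := R) p h10').symm)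
      all_goals rfl
    · rw [quasiIsoAt_iff_exactAt']
      · apply hR
      · apply ChainComplex.exactAt_succ_single_obj
  · obtain (_ | _ | _ | n) := n
    exacts [h₀, h₁, h₂, h₃]
  · obtain (_ | _ | _ | n) := n
    · lia
    · lia
    · lia
    · exact hZ

lemma factorThruImage_shortComplex_zero (S : ShortComplex A) : S.f ≫ factorThruImage S.g = 0 := by
  rw [← cancel_mono (image.ι S.g), Category.assoc, image.fac, S.zero, zero_comp]

lemma shortExact_factorThruImage {S : ShortComplex A} (hS : S.Exact) [Mono S.f] :
    (ShortComplex.mk _ _ (factorThruImage_shortComplex_zero S)).ShortExact where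
  exact := (ShortComplex.exact_iff_of_epi_of_isIso_of_mono
    (S₁ := ShortComplex.mk _ _ (factorThruImage_shortComplex_zero S)) (S₂ := S)
    { τ₁ := 𝟙 _, τ₂ := 𝟙 _, τ₃ := image.ι S.g }).2 hS

lemma image_ι_shortComplex_zero (S : ShortComplex A) : image.ι S.f ≫ S.g = 0 := by
  rw [← cancel_epi (factorThruImage S.f), image.fac_assoc, S.zero, comp_zero]

lemma shortExact_image_ι {S : ShortComplex A} (hS : S.Exact) [Epi S.g] :
    (ShortComplex.mk _ _ (image_ι_shortComplex_zero S)).ShortExact where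
  exact := (ShortComplex.exact_iff_of_epi_of_isIso_of_mono (S₁ := S)
    (S₂ := ShortComplex.mk _ _ (image_ι_shortComplex_zero S))
    { τ₁ := factorThruImage S.f, τ₂ := 𝟙 _, τ₃ := 𝟙 _ }).1 hS

/-- A class of objects consisting of the projective objects is a `2`-cotilting torsion-free class
when all objects have projective dimension at most `2`. -/
lemma isTwoCotiltingTorsionFreeClass_of_projective (hP : ∀ X, Projective X ↔ P X)
    [EnoughProjectives A] (hA : ∀ X : A, HasProjectiveDimensionLT X 3)
    (hP' : HasCokernels P.FullSubcategory) : IsTwoCotiltingTorsionFreeClass P where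
  generates X := ⟨_, Projective.π X, (hP _).1 inferInstance, inferInstance⟩
  closedUnderExtensions := ⟨fun {S} hS h₁ h₃ ↦ by
    rw [← hP, projective_iff_hasProjectiveDimensionLT_one] at h₁ h₃ ⊢
    exact hS.hasProjectiveDimensionLT_X₂ 1 h₁ h₃⟩
  hasCokernels := hP'
  prop_of_exact S hS _ h₂ h₃ := by
    rw [← hP] at h₂ h₃ ⊢
    rw [projective_iff_hasProjectiveDimensionLT_one]
    -- `S.X₁` is a second syzygy of this cokernel, through the image of `S.g`; two dimension shifts
    -- lower the bound from 2 to 0.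
    have := hA (cokernel S.g)
    have h := (shortExact_image_ι (ShortComplex.exact_cokernel S.g)).hasProjectiveDimensionLT_X₃_iff
      1 h₃
    exact ((shortExact_factorThruImage hS).hasProjectiveDimensionLT_X₃_iff 0 h₂).1 (h.1 this)

/-- A class of objects consisting of the injective objects is a `2`-tilting torsion class
when all objects have injective dimension at most `2`. -/
lemma isTwoTiltingTorsionClass_of_injective (hP : ∀ X, Injective X ↔ P X)
    [EnoughInjectives A] (hA : ∀ X : A, HasInjectiveDimensionLT X 3)
    (hP' : HasKernels P.FullSubcategory) : IsTwoTiltingTorsionClass P where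
  cogenerates X := ⟨_, Injective.ι X, (hP _).1 inferInstance, inferInstance⟩
  closedUnderExtensions := ⟨fun {S} hS h₁ h₃ ↦ by
    rw [← hP, injective_iff_hasInjectiveDimensionLT_one] at h₁ h₃ ⊢
    exact hS.hasInjectiveDimensionLT_X₂ 1 h₁ h₃⟩
  hasKernels := hP'
  prop_of_exact S hS _ h₁ h₂ := by
    rw [← hP] at h₁ h₂ ⊢
    rw [injective_iff_hasInjectiveDimensionLT_one]
    have := hA (kernel S.f)
    have h := (shortExact_factorThruImage
      (ShortComplex.exact_kernel S.f)).hasInjectiveDimensionLT_X₃_iff 1 h₁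
    exact ((shortExact_image_ι hS).hasInjectiveDimensionLT_X₃_iff 0 h₂).2 (h.2 this)

end Abelian

/-! ### The category E inside a heart that contains it. -/

section

variable {E : Type u} [Category.{v} E] [Preadditive E] [HasZeroObject E] [HasBinaryBiproducts E]
  (t : TStructure (HomotopyCategory E (ComplexShape.up ℤ)))
  (h : ∀ X : E, t.heart ((HomotopyCategory.singleFunctor E 0).obj X))

lemma toHeart_essImage : (toHeart t h).essImage = inHeart t := by
  ext X
  constructor
  · rintro ⟨Y, ⟨e⟩⟩
    exact ⟨Y, ⟨t.heart.ι.mapIso e⟩⟩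
  · rintro ⟨Y, ⟨e⟩⟩
    exact ⟨Y, ⟨t.heart.isoMk e⟩⟩

instance : (toHeart t h).Full := by
  have := singleFunctor_full E
  infer_instance

instance : (toHeart t h).Faithful := by
  have := singleFunctor_faithful E
  infer_instance

/-- `E` identifies to the full subcategory of a heart containing the objects of `E`. -/
noncomputable def toHeartEquivalence : E ≌ (inHeart t).FullSubcategory :=
  let F := (inHeart t).lift (toHeart t h) (fun X ↦ ⟨X, ⟨Iso.refl _⟩⟩)
  have : F.EssSurj := ⟨fun ⟨X, ⟨Y, ⟨e⟩⟩⟩ ↦ ⟨Y, ⟨(inHeart t).isoMk (t.heart.isoMk e)⟩⟩⟩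
  have : F.Full := Functor.Full.of_comp_faithful_iso ((inHeart t).liftCompιIso (toHeart t h) _)
  have : F.Faithful := Functor.Faithful.of_comp_iso ((inHeart t).liftCompιIso (toHeart t h) _)
  have : F.IsEquivalence := { }
  F.asEquivalence

include h in
lemma hasKernels_inHeart [HasKernels E] : HasKernels (inHeart t).FullSubcategory := by
  have : HasEqualizers E := Preadditive.hasEqualizers_of_hasKernels
  have : HasEqualizers (inHeart t).FullSubcategory :=
    Adjunction.hasLimitsOfShape_of_equivalence (toHeartEquivalence t h).inverse
  infer_instance

include h in
lemma hasCokernels_inHeart [HasCokernels E] : HasCokernels (inHeart t).FullSubcategory := by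
  have : HasCoequalizers E := Preadditive.hasCoequalizers_of_hasCokernels
  have : HasCoequalizers (inHeart t).FullSubcategory :=
    Adjunction.hasColimitsOfShape_of_equivalence (toHeartEquivalence t h).inverse
  infer_instance

end

/-! ### Projectives of the left heart and injectives of the right heart. -/

section

variable {E : Type u} [Category.{v} E] [Preadditive E] [HasZeroObject E] [HasBinaryBiproducts E]
  [HasKernels E] [HasCokernels E]

/-- Brutal truncation between degrees -1 and 0 gives a triangle B⟦-1⟧ ⟶ A ⟶ X. Here A is an
extension of X by B⟦-1⟧, both in the aisle, and it has a model in degrees ≥ 0, so it comes from E.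
The rotated triangle X⟦-1⟧ ⟶ B⟦-1⟧ ⟶ A puts B⟦-1⟧ in the coaisle, hence in the heart. -/
lemma leftTStructure_exists_shortExact (X : (leftTStructure E).heart.FullSubcategory) :
    ∃ (K P : (leftTStructure E).heart.FullSubcategory) (i : K ⟶ P) (p : P ⟶ X) (w : i ≫ p = 0),
      (ShortComplex.mk i p w).ShortExact ∧ inHeart _ P := by
  obtain ⟨X, hX⟩ := X
  obtain ⟨h₁, h₂⟩ := (TStructure.mem_heart_iff _ _).1 hX
  obtain ⟨A, B, hA, hB, f, g, δ, hT⟩ :=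
    exists_distinguished_triangle_homotopyGE_homotopyLE X (-1) 0 (by lia)
  have hT' := inv_rot_of_distTriang _ hT
  have hB' : (leftTStructure E).IsLE (B⟦(-1 : ℤ)⟧) 0 := ⟨homotopyLE_shift _ _ _ (by lia) _ hB⟩
  have hA₁ : (leftTStructure E).IsLE A 0 := TStructure.isLE₂ _ _ hT' 0 hB' h₁
  have hA₂ : (leftTStructure E).IsGE A 0 := ⟨rightTStructure_ge_le_leftTStructure_ge _ _ hA⟩
  have : (leftTStructure E).IsGE (X⟦(-1 : ℤ)⟧) 1 := TStructure.isGE_shift _ _ 0 (-1) 1 (by lia)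
  have hB'' : (leftTStructure E).IsGE (B⟦(-1 : ℤ)⟧) 0 :=
    TStructure.isGE₂ _ _ (inv_rot_of_distTriang _ hT') 0
      (TStructure.isGE_of_ge _ (X⟦(-1 : ℤ)⟧) 0 1) hA₂
  let P : (leftTStructure E).heart.FullSubcategory :=
    ⟨A, (TStructure.mem_heart_iff _ _).2 ⟨hA₁, hA₂⟩⟩
  let K : (leftTStructure E).heart.FullSubcategory :=
    ⟨B⟦(-1 : ℤ)⟧, (TStructure.mem_heart_iff _ _).2 ⟨hB', hB''⟩⟩
  obtain ⟨w, hw⟩ := heart_shortExact (leftTStructure E) (X₁ := K) (X₂ := P) (X₃ := ⟨X, hX⟩)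
    (ObjectProperty.homMk (Triangle.mk f g δ).invRotate.mor₁) (ObjectProperty.homMk f) _ hT'
  exact ⟨K, P, _, _, w, hw, essImage_singleFunctor_of_homotopyLE_of_homotopyGE hA₁.le hA⟩

/-- In the triangle X₃⟦-1⟧ ⟶ X₁ ⟶ X₂ the shift gains one degree, until the bound 0 for objects of E
is reached; hence `m ≤ 0`. -/
lemma leftTStructure_ge_of_shortExact {S : ShortComplex (leftTStructure E).heart.FullSubcategory}
    (hS : S.ShortExact) (hP : inHeart _ S.X₂) (n m : ℤ) (h : n + 1 = m) (hm : m ≤ 0)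
    (h₃ : homotopyGE E n S.X₃.obj) : homotopyGE E m S.X₁.obj := by
  obtain ⟨δ, hT⟩ := heart_exists_distinguished_triangle _ hS
  have hP' : (rightTStructure E).IsGE S.X₂.obj m :=
    ⟨homotopyGE_antitone hm _ (by
      obtain ⟨Y, ⟨e⟩⟩ := hP
      exact (homotopyGE E 0).prop_of_iso e (homotopyGE_singleFunctor_obj Y 0))⟩
  exact (TStructure.isGE₂ (rightTStructure E) _ (inv_rot_of_distTriang _ hT) m
    ⟨homotopyGE_shift n (-1) m (by lia) _ h₃⟩ hP').ge

omit [HasCokernels E] in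
lemma leftTStructure_projective {P : (leftTStructure E).heart.FullSubcategory}
    (hP : inHeart _ P) : Projective P := by
  obtain ⟨X, ⟨e⟩⟩ := hP
  exact heart_projective _ _ (fun Y hY f ↦
    hom_eq_zero_of_homotopyGE_of_homotopyLE (by lia : (-1 : ℤ) < 0)
      ((homotopyGE E 0).prop_of_iso e (homotopyGE_singleFunctor_obj X 0)) hY f)

lemma leftTStructure_exists_resolution (X : (leftTStructure E).heart.FullSubcategory) :
    ∃ (K P₀ P₁ P₂ : (leftTStructure E).heart.FullSubcategory) (i : K ⟶ P₀) (p : P₀ ⟶ X)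
      (w : i ≫ p = 0) (j : P₂ ⟶ P₁) (s : P₁ ⟶ K) (w' : j ≫ s = 0),
      (ShortComplex.mk i p w).ShortExact ∧ (ShortComplex.mk j s w').ShortExact ∧
        inHeart _ P₀ ∧ inHeart _ P₁ ∧ inHeart _ P₂ := by
  obtain ⟨K, P₀, i, p, w, hS, hP₀⟩ := leftTStructure_exists_shortExact X
  obtain ⟨P₂, P₁, j, s, w', hT, hP₁⟩ := leftTStructure_exists_shortExact K
  refine ⟨K, P₀, P₁, P₂, i, p, w, j, s, w', hS, hT, hP₀, hP₁,
    essImage_singleFunctor_of_homotopyLE_of_homotopyGE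
      ((TStructure.mem_heart_iff _ _).1 P₂.property).1.le ?_⟩
  -- `X` lies in R^{≥ -2}, so its first syzygy lies in R^{≥ -1} and its second in R^{≥ 0}, which
  -- places the latter in E.
  refine leftTStructure_ge_of_shortExact hT hP₁ (-1) 0 (by lia) (by lia) ?_
  refine leftTStructure_ge_of_shortExact hS hP₀ (-2) (-1) (by lia) (by lia) ?_
  exact leftTStructure_ge_le_rightTStructure_ge 0 (-2) (by lia) _
    ((TStructure.mem_heart_iff _ _).1 X.property).2.ge

variable (E) in
lemma leftTStructure_enoughProjectives :
    EnoughProjectives (leftTStructure E).heart.FullSubcategory where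
  presentation X := by
    obtain ⟨K, P, i, p, w, hS, hP⟩ := leftTStructure_exists_shortExact X
    exact ⟨{ p := P, projective := leftTStructure_projective hP, f := p, epi := hS.epi_g }⟩

/-- A projective P is a retract of an object of E. The coaisle R^{≥ 0} is an orthogonal, hence
closed under retracts, so P is in both K^{≤ 0} and K^{≥ 0}. -/
lemma leftTStructure_projective_iff (P : (leftTStructure E).heart.FullSubcategory) :
    Projective P ↔ inHeart _ P := by
  refine ⟨fun _ ↦ ?_, leftTStructure_projective⟩
  obtain ⟨K, P₀, i, p, w, hS, hP₀⟩ := leftTStructure_exists_shortExact P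
  have : Epi p := hS.epi_g
  let s := Projective.factorThru (𝟙 P) p
  have hs : s.hom ≫ p.hom = 𝟙 _ := congrArg (·.hom) (Projective.factorThru_comp (𝟙 P) p)
  obtain ⟨X, ⟨e⟩⟩ := hP₀
  have : (rightTStructure E).IsGE P₀.obj 0 :=
    ⟨(homotopyGE E 0).prop_of_iso e (homotopyGE_singleFunctor_obj X 0)⟩
  refine essImage_singleFunctor_of_homotopyLE_of_homotopyGE
    ((TStructure.mem_heart_iff _ _).1 P.property).1.le
    (show (rightTStructure E).IsGE P.obj 0 from ?_).ge
  rw [TStructure.isGE_iff_orthogonal _ (-1) 0 (by lia)]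
  intro Y f _
  rw [← Category.comp_id f, ← hs, ← Category.assoc,
    TStructure.zero (rightTStructure E) (f ≫ s.hom) (-1) 0 (by lia), zero_comp]

lemma leftTStructure_hasProjectiveDimensionLT
    (X : (leftTStructure E).heart.FullSubcategory) : HasProjectiveDimensionLT X 3 := by
  obtain ⟨K, P₀, P₁, P₂, i, p, w, j, s, w', hS, hT, h₀, h₁, h₂⟩ :=
    leftTStructure_exists_resolution X
  rw [← leftTStructure_projective_iff] at h₀ h₁ h₂
  refine (hS.hasProjectiveDimensionLT_X₃_iff 1 h₀).2 ?_
  exact (hT.hasProjectiveDimensionLT_X₃_iff 0 h₁).2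
    (projective_iff_hasProjectiveDimensionLT_one.1 h₂)

/-- The cut is now between degrees 0 and 1, and the triangle X ⟶ B ⟶ A⟦1⟧ has its middle term B in
E. -/
lemma rightTStructure_exists_shortExact (X : (rightTStructure E).heart.FullSubcategory) :
    ∃ (I Q : (rightTStructure E).heart.FullSubcategory) (i : X ⟶ I) (p : I ⟶ Q) (w : i ≫ p = 0),
      (ShortComplex.mk i p w).ShortExact ∧ inHeart _ I := by
  obtain ⟨X, hX⟩ := X
  obtain ⟨h₁, h₂⟩ := (TStructure.mem_heart_iff _ _).1 hX
  obtain ⟨A, B, hA, hB, f, g, δ, hT⟩ :=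
    exists_distinguished_triangle_homotopyGE_homotopyLE X 0 1 (by lia)
  have hT' := rot_of_distTriang _ hT
  have hA' : (rightTStructure E).IsGE (A⟦(1 : ℤ)⟧) 0 := ⟨homotopyGE_shift _ _ _ (by lia) _ hA⟩
  have hB₂ : (rightTStructure E).IsGE B 0 := TStructure.isGE₂ _ _ hT' 0 h₂ hA'
  have hB₁ : (rightTStructure E).IsLE B 0 := ⟨leftTStructure_le_le_rightTStructure_le _ _ hB⟩
  have : (rightTStructure E).IsLE (X⟦(1 : ℤ)⟧) (-1) := TStructure.isLE_shift _ _ 0 1 (-1) (by lia)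
  have hA'' : (rightTStructure E).IsLE (A⟦(1 : ℤ)⟧) 0 :=
    TStructure.isLE₂ _ _ (rot_of_distTriang _ hT') 0 hB₁
      (TStructure.isLE_of_le _ (X⟦(1 : ℤ)⟧) (-1) 0)
  let I : (rightTStructure E).heart.FullSubcategory :=
    ⟨B, (TStructure.mem_heart_iff _ _).2 ⟨hB₁, hB₂⟩⟩
  let Q : (rightTStructure E).heart.FullSubcategory :=
    ⟨A⟦(1 : ℤ)⟧, (TStructure.mem_heart_iff _ _).2 ⟨hA'', hA'⟩⟩
  obtain ⟨w, hw⟩ := heart_shortExact (rightTStructure E) (X₁ := ⟨X, hX⟩) (X₂ := I) (X₃ := Q)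
    (ObjectProperty.homMk g) (ObjectProperty.homMk δ) _ hT'
  exact ⟨I, Q, _, _, w, hw, essImage_singleFunctor_of_homotopyLE_of_homotopyGE hB hB₂.ge⟩

lemma rightTStructure_le_of_shortExact
    {S : ShortComplex (rightTStructure E).heart.FullSubcategory}
    (hS : S.ShortExact) (hI : inHeart _ S.X₂) (n m : ℤ) (h : m + 1 = n) (hm : 0 ≤ m)
    (h₁ : homotopyLE E n S.X₁.obj) : homotopyLE E m S.X₃.obj := by
  obtain ⟨δ, hT⟩ := heart_exists_distinguished_triangle _ hS
  have hI' : (leftTStructure E).IsLE S.X₂.obj m :=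
    ⟨homotopyLE_monotone hm _ (by
      obtain ⟨Y, ⟨e⟩⟩ := hI
      exact (homotopyLE E 0).prop_of_iso e (homotopyLE_singleFunctor_obj Y 0))⟩
  exact (TStructure.isLE₂ (leftTStructure E) _ (rot_of_distTriang _ hT) m hI'
    ⟨homotopyLE_shift n 1 m (by lia) _ h₁⟩).le

omit [HasKernels E] in
lemma rightTStructure_injective {I : (rightTStructure E).heart.FullSubcategory}
    (hI : inHeart _ I) : Injective I := by
  obtain ⟨X, ⟨e⟩⟩ := hI
  exact heart_injective _ _ (fun Y hY f ↦
    hom_eq_zero_of_homotopyGE_of_homotopyLE (by lia : (0 : ℤ) < 1) hY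
      ((homotopyLE E 0).prop_of_iso e (homotopyLE_singleFunctor_obj X 0)) f)

variable (E) in
lemma rightTStructure_enoughInjectives :
    EnoughInjectives (rightTStructure E).heart.FullSubcategory where
  presentation X := by
    obtain ⟨I, Q, i, p, w, hS, hI⟩ := rightTStructure_exists_shortExact X
    exact ⟨{ J := I, injective := rightTStructure_injective hI, f := i, mono := hS.mono_f }⟩

lemma rightTStructure_injective_iff (I : (rightTStructure E).heart.FullSubcategory) :
    Injective I ↔ inHeart _ I := by
  refine ⟨fun _ ↦ ?_, rightTStructure_injective⟩
  obtain ⟨I₀, Q, i, p, w, hS, hI₀⟩ := rightTStructure_exists_shortExact I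
  have : Mono i := hS.mono_f
  let r := Injective.factorThru (𝟙 I) i
  have hr : i.hom ≫ r.hom = 𝟙 _ := congrArg (·.hom) (Injective.comp_factorThru (𝟙 I) i)
  obtain ⟨X, ⟨e⟩⟩ := hI₀
  have : (leftTStructure E).IsLE I₀.obj 0 :=
    ⟨(homotopyLE E 0).prop_of_iso e (homotopyLE_singleFunctor_obj X 0)⟩
  refine essImage_singleFunctor_of_homotopyLE_of_homotopyGE
    (show (leftTStructure E).IsLE I.obj 0 from ?_).le
    ((TStructure.mem_heart_iff _ _).1 I.property).2.ge
  rw [TStructure.isLE_iff_orthogonal _ 0 1 (by lia)]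
  intro Y f _
  rw [← Category.id_comp f, ← hr, Category.assoc,
    TStructure.zero (leftTStructure E) (r.hom ≫ f) 0 1 (by lia), comp_zero]

lemma rightTStructure_hasInjectiveDimensionLT
    (X : (rightTStructure E).heart.FullSubcategory) : HasInjectiveDimensionLT X 3 := by
  obtain ⟨I₀, Q, i, p, w, hS, h₀⟩ := rightTStructure_exists_shortExact X
  obtain ⟨I₁, I₂, j, s, w', hT, h₁⟩ := rightTStructure_exists_shortExact Q
  have h₂ : inHeart _ I₂ := by
    refine essImage_singleFunctor_of_homotopyLE_of_homotopyGE ?_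
      ((TStructure.mem_heart_iff _ _).1 I₂.property).2.ge
    refine rightTStructure_le_of_shortExact hT h₁ 1 0 (by lia) (by lia) ?_
    refine rightTStructure_le_of_shortExact hS h₀ 2 1 (by lia) (by lia) ?_
    exact rightTStructure_le_le_leftTStructure_le 2 0 (by lia) _
      ((TStructure.mem_heart_iff _ _).1 X.property).1.le
  rw [← rightTStructure_injective_iff] at h₀ h₁ h₂
  refine (hS.hasInjectiveDimensionLT_X₃_iff 1 h₀).1 ?_
  exact (hT.hasInjectiveDimensionLT_X₃_iff 0 h₁).1
    (injective_iff_hasInjectiveDimensionLT_one.1 h₂)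

end

/-! ### Endofunctors determined on projective generators or injective cogenerators. -/

section Generators

universe v' u'

variable {A : Type u} [Category.{v} A] [Abelian A] {E : Type u'} [Category.{v'} E] (J : E ⥤ A)
  [J.Full]

/-- A fully faithful endofunctor of an abelian category `A` is isomorphic to the identity if it
is so on a full subcategory consisting of projective objects which generate `A`. -/
lemma nonempty_iso_id_of_projective (hJ : ∀ M, Projective (J.obj M))
    (hJ' : ∀ X : A, ∃ (M : E) (p : J.obj M ⟶ X), Epi p) (Θ : A ⥤ A) [Θ.Full] [Θ.Faithful]
    [Θ.PreservesZeroMorphisms] (β : J ⋙ Θ ≅ J) : Nonempty (Θ ≅ 𝟭 A) := by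
  have hβ {M N : E} (k : J.obj M ⟶ J.obj N) : k ≫ β.inv.app N = β.inv.app M ≫ Θ.map k := by
    obtain ⟨k, rfl⟩ := J.map_surjective k
    exact β.inv.naturality k
  have ext {X Y : A} (a b : X ⟶ Y) (hab : ∀ (M : E) (f : J.obj M ⟶ X), f ≫ a = f ≫ b) :
      a = b := by
    obtain ⟨M, p, _⟩ := hJ' X
    rw [← cancel_epi p, hab]
  have hα (X : A) : ∃ α : X ⟶ Θ.obj X,
      ∀ (M : E) (f : J.obj M ⟶ X), f ≫ α = β.inv.app M ≫ Θ.map f := by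
    obtain ⟨M, p, _⟩ := hJ' X
    refine ⟨Abelian.epiDesc p (β.inv.app M ≫ Θ.map p) ?_, fun N f ↦ ?_⟩
    · refine ext _ _ (fun N f ↦ ?_)
      have := hβ (f ≫ kernel.ι p)
      rw [← Category.assoc, ← Category.assoc, this, Category.assoc, ← Θ.map_comp,
        Category.assoc, kernel.condition, comp_zero, comp_zero, Functor.map_zero, comp_zero]
    · obtain ⟨g, rfl⟩ : ∃ g, g ≫ p = f := ⟨_, Projective.factorThru_comp f p⟩
      rw [Category.assoc, Abelian.comp_epiDesc, ← Category.assoc, hβ, Category.assoc,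
        ← Θ.map_comp]
  choose α hα using hα
  -- On maps from generators, `α X` acts as f ↦ Θ(f) up to `β`: faithfulness of `Θ` makes it a
  -- monomorphism, fullness an epimorphism.
  have (X : A) : IsIso (α X) := by
    have : Mono (α X) := by
      rw [Preadditive.mono_iff_cancel_zero]
      intro P g hg
      refine ext _ _ (fun M f ↦ Θ.map_injective ?_)
      rw [← cancel_epi (β.inv.app M), ← hα, Category.assoc, hg, comp_zero, comp_zero,
        Functor.map_zero, comp_zero]
    have : Epi (α X) := by
      obtain ⟨M, p, _⟩ := hJ' (Θ.obj X)
      obtain ⟨f, hf⟩ := Θ.map_surjective (β.hom.app M ≫ p)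
      have hf' : f ≫ α X = p := by rw [hα, hf, Iso.inv_hom_id_app_assoc]
      exact epi_of_epi_fac hf'
    exact isIso_of_mono_of_epi _
  refine ⟨(NatIso.ofComponents (F := 𝟭 A) (G := Θ) (fun X ↦ @asIso _ _ _ _ (α X) (this X))
    (fun {X Y} f ↦ ?_)).symm⟩
  refine ext _ _ (fun M g ↦ ?_)
  change g ≫ f ≫ α Y = g ≫ α X ≫ Θ.map f
  rw [← Category.assoc, hα, reassoc_of% (hα X M g), Functor.map_comp]

/-- A fully faithful endofunctor of an abelian category `A` is isomorphic to the identity if it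
is so on a full subcategory consisting of injective objects which cogenerate `A`. -/
lemma nonempty_iso_id_of_injective (hJ : ∀ M, Injective (J.obj M))
    (hJ' : ∀ X : A, ∃ (M : E) (i : X ⟶ J.obj M), Mono i) (Θ : A ⥤ A) [Θ.Full] [Θ.Faithful]
    [Θ.PreservesZeroMorphisms] (β : J ⋙ Θ ≅ J) : Nonempty (Θ ≅ 𝟭 A) := by
  have : Θ.op.PreservesZeroMorphisms := ⟨fun X Y ↦
    congrArg Quiver.Hom.op (Θ.map_zero Y.unop X.unop)⟩
  obtain ⟨e⟩ := nonempty_iso_id_of_projective J.op (fun _ ↦ inferInstanceAs (Projective (Opposite.op _)))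
    (fun X ↦ by
      obtain ⟨M, i, _⟩ := hJ' X.unop
      exact ⟨.op M, i.op, inferInstance⟩) Θ.op ((Functor.opComp _ _).symm ≪≫ NatIso.op β.symm)
  exact ⟨(NatIso.removeOp (F := Θ) (G := 𝟭 A) e).symm⟩

end Generators

/-! ### Exactness tested on projectives or injectives. -/

section Exactness

variable {A : Type u} [Category.{v} A] [Abelian A]

lemma exact_of_projective [EnoughProjectives A] (S : ShortComplex A)
    (hS : ∀ (P : A) [Projective P] (f : P ⟶ S.X₂), f ≫ S.g = 0 → ∃ g, g ≫ S.f = f) :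
    S.Exact := by
  rw [S.exact_iff_epi_toCycles]
  let p := Projective.π S.cycles
  obtain ⟨g, hg⟩ := hS _ (p ≫ S.iCycles) (by simp)
  refine epi_of_epi_fac (f := g) (h := p) ?_
  rw [← cancel_mono S.iCycles, Category.assoc, S.toCycles_i, hg]

lemma exact_of_injective [EnoughInjectives A] (S : ShortComplex A)
    (hS : ∀ (I : A) [Injective I] (f : S.X₂ ⟶ I), S.f ≫ f = 0 → ∃ g, S.g ≫ g = f) :
    S.Exact := by
  rw [S.exact_iff_mono_fromOpcycles]
  let i := Injective.ι S.opcycles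
  obtain ⟨g, hg⟩ := hS _ (S.pOpcycles ≫ i) (by simp)
  have fac : S.fromOpcycles ≫ g = i := by
    rw [← cancel_epi S.pOpcycles, S.p_fromOpcycles_assoc, hg]
  exact mono_of_mono_fac fac

end Exactness

/-! ### Triangulated inverses and t-exact functors. -/

section

variable {C D : Type*} [Category* C] [Category* D] [HasZeroObject C] [HasZeroObject D]
  [Preadditive C] [Preadditive D] [HasShift C ℤ] [HasShift D ℤ]
  [∀ (n : ℤ), (shiftFunctor C n).Additive] [∀ (n : ℤ), (shiftFunctor D n).Additive]
  [Pretriangulated C] [Pretriangulated D]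

lemma exists_commShift_isTriangulated_inverse (F : C ⥤ D) [F.CommShift ℤ] [F.IsTriangulated]
    [F.IsEquivalence] :
    ∃ _ : F.asEquivalence.inverse.CommShift ℤ, F.asEquivalence.inverse.IsTriangulated := by
  let adj : F ⊣ F.asEquivalence.inverse := F.asEquivalence.toAdjunction
  let := adj.rightAdjointCommShift ℤ
  have := adj.commShift_of_leftAdjoint ℤ
  exact ⟨inferInstance, adj.isTriangulated_rightAdjoint⟩

variable (t : TStructure C) (t' : TStructure D)
  (F : C ⥤ D) [F.CommShift ℤ] [F.Faithful] [F.Additive]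

omit [F.Faithful] [F.Additive] in
lemma le_obj_of_le_zero (hle : ∀ X, t.le 0 X → t'.le 0 (F.obj X)) (n : ℤ) (X : C)
    (hX : t.le n X) : t'.le n (F.obj X) := by
  have := hle _ (t.le_shift n n 0 (by lia) X hX)
  rw [← t'.shift_le n 0 n (by lia)]
  exact (t'.le 0).prop_of_iso ((F.commShiftIso n).app X) this

omit [F.Faithful] [F.Additive] in
lemma ge_obj_of_ge_zero (hge : ∀ X, t.ge 0 X → t'.ge 0 (F.obj X)) (n : ℤ) (X : C)
    (hX : t.ge n X) : t'.ge n (F.obj X) := by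
  have := hge _ (t.ge_shift n n 0 (by lia) X hX)
  rw [← t'.shift_ge n 0 n (by lia)]
  exact (t'.ge 0).prop_of_iso ((F.commShiftIso n).app X) this

/-- A faithful t-exact functor reflects aisles, because membership is the vanishing of maps to the
coaisle, which can be checked after applying `F`. -/
lemma le_obj_iff (hle : ∀ X, t.le 0 X → t'.le 0 (F.obj X))
    (hge : ∀ X, t.ge 0 X → t'.ge 0 (F.obj X)) (n : ℤ) (X : C) :
    t'.le n (F.obj X) ↔ t.le n X := by
  refine ⟨fun hX ↦ ?_, le_obj_of_le_zero t t' F hle n X⟩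
  suffices t.IsLE X n from this.le
  rw [t.isLE_iff_orthogonal n (n + 1) rfl]
  intro Y f hY
  have h₁ : t'.IsLE (F.obj X) n := ⟨hX⟩
  have h₂ : t'.IsGE (F.obj Y) (n + 1) := ⟨ge_obj_of_ge_zero t t' F hge _ _ hY.ge⟩
  exact F.map_injective (by rw [t'.zero (F.map f) n (n + 1), F.map_zero])

lemma ge_obj_iff (hle : ∀ X, t.le 0 X → t'.le 0 (F.obj X))
    (hge : ∀ X, t.ge 0 X → t'.ge 0 (F.obj X)) (n : ℤ) (X : C) :
    t'.ge n (F.obj X) ↔ t.ge n X := by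
  refine ⟨fun hX ↦ ?_, ge_obj_of_ge_zero t t' F hge n X⟩
  suffices t.IsGE X n from this.ge
  rw [t.isGE_iff_orthogonal (n - 1) n (by lia)]
  intro Y f hY
  have h₁ : t'.IsGE (F.obj X) n := ⟨hX⟩
  have h₂ : t'.IsLE (F.obj Y) (n - 1) := ⟨le_obj_of_le_zero t t' F hle _ _ hY.le⟩
  exact F.map_injective (by rw [t'.zero (F.map f) (n - 1) n (by lia), F.map_zero])

end

/-! ### Realization functors that extend the inclusion of the heart. -/

section Realization

variable {E : Type u} [Category.{v} E] [Preadditive E] [HasZeroObject E] [HasBinaryBiproducts E]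

/-- The functor `toDerived J` extends the functor `J`. -/
noncomputable def singleFunctorCompToDerivedIso {A : Type*} [Category* A] [Abelian A]
    [HasDerivedCategory A] (J : E ⥤ A) [J.Additive] :
    HomotopyCategory.singleFunctor E 0 ⋙ toDerived J ≅ J ⋙ DerivedCategory.singleFunctor A 0 :=
  let i₁ : HomotopyCategory.quotient E (ComplexShape.up ℤ) ⋙ toDerived J ≅
      J.mapHomologicalComplex (ComplexShape.up ℤ) ⋙ DerivedCategory.Q :=
    (Functor.associator _ _ _).symm ≪≫
      Functor.isoWhiskerRight (J.mapHomotopyCategoryFactors _) DerivedCategory.Qh ≪≫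
      Functor.associator _ _ _ ≪≫ Functor.isoWhiskerLeft _ (DerivedCategory.quotientCompQhIso A)
  let i₂ : CochainComplex.singleFunctor E 0 ⋙ J.mapHomologicalComplex (ComplexShape.up ℤ) ≅
      J ⋙ CochainComplex.singleFunctor A 0 :=
    HomologicalComplex.singleMapHomologicalComplex J (ComplexShape.up ℤ) 0
  (show HomotopyCategory.singleFunctor E 0 ⋙ toDerived J ≅ CochainComplex.singleFunctor E 0 ⋙
    HomotopyCategory.quotient E (ComplexShape.up ℤ) ⋙ toDerived J from Iso.refl _) ≪≫
    Functor.isoWhiskerLeft _ i₁ ≪≫ (Functor.associator _ _ _).symm ≪≫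
    Functor.isoWhiskerRight i₂ DerivedCategory.Q ≪≫ Functor.associator _ _ _ ≪≫
    Functor.isoWhiskerLeft J (DerivedCategory.singleFunctorIsoCompQ A 0).symm

variable (t : TStructure (HomotopyCategory E (ComplexShape.up ℤ)))
  (h : ∀ X : E, t.heart ((HomotopyCategory.singleFunctor E 0).obj X))

/-- By t-exactness, `toDerived` carries the heart into complexes concentrated in degree 0, so it
induces a fully faithful endofunctor Θ of the heart that fixes E. The hypothesis `hΘ` identifies Θ
with the identity, which says exactly that the inverse equivalence extends the inclusion. -/
lemma exists_isDerivedRealization [(toDerived (toHeart t h)).IsEquivalence]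
    (hle : ∀ X, t.le 0 X → DerivedCategory.TStructure.t.le 0 ((toDerived (toHeart t h)).obj X))
    (hge : ∀ X, t.ge 0 X → DerivedCategory.TStructure.t.ge 0 ((toDerived (toHeart t h)).obj X))
    (hΘ : ∀ (Θ : t.heart.FullSubcategory ⥤ t.heart.FullSubcategory) [Θ.Full] [Θ.Faithful]
      [Θ.PreservesZeroMorphisms] (_ : toHeart t h ⋙ Θ ≅ toHeart t h), Nonempty (Θ ≅ 𝟭 _)) :
    ∃ (_ : (toDerived (toHeart t h)).asEquivalence.inverse.CommShift ℤ),
      IsDerivedRealization t (toDerived (toHeart t h)).asEquivalence.inverse := by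
  let Φ := toDerived (toHeart t h)
  let e : _ ≌ DerivedCategory t.heart.FullSubcategory := Φ.asEquivalence
  let S := DerivedCategory.singleFunctor t.heart.FullSubcategory 0
  obtain ⟨_, _⟩ := exists_commShift_isTriangulated_inverse Φ
  have hS (X : t.heart.FullSubcategory) : S.essImage ((t.heart.ι ⋙ Φ).obj X) := by
    have hX := (t.mem_heart_iff _).1 X.property
    have : (Φ.obj X.obj).IsLE 0 := ⟨hle _ hX.1.le⟩
    have : (Φ.obj X.obj).IsGE 0 := ⟨hge _ hX.2.ge⟩
    obtain ⟨Y, ⟨i⟩⟩ := DerivedCategory.exists_iso_singleFunctor_obj_of_isGE_of_isLE (Φ.obj X.obj) 0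
    exact ⟨Y, ⟨i.symm⟩⟩
  let Θ := Functor.essImage.liftFunctor (t.heart.ι ⋙ Φ) S hS
  let α : Θ ⋙ S ≅ t.heart.ι ⋙ Φ := Functor.essImage.liftFunctorCompIso _ _ _
  have : Θ.Full := Functor.Full.of_comp_faithful_iso α
  have : Θ.Faithful := Functor.Faithful.of_comp_iso α
  have : Θ.Additive := by
    have := Functor.additive_of_iso α.symm
    exact Functor.additive_of_comp_faithful Θ S
  obtain ⟨γ⟩ := hΘ Θ (Functor.fullyFaithfulCancelRight S
    (Functor.associator _ _ _ ≪≫ Functor.isoWhiskerLeft _ α ≪≫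
      singleFunctorCompToDerivedIso (toHeart t h)))
  refine ⟨inferInstance, inferInstance, inferInstance, ⟨?_⟩, fun n X ↦ ?_, fun n X ↦ ?_⟩
  · exact Functor.isoWhiskerRight ((Functor.leftUnitor _).symm ≪≫
      Functor.isoWhiskerRight γ.symm S ≪≫ α) e.inverse ≪≫ Functor.associator _ _ _ ≪≫
      Functor.isoWhiskerLeft _ e.unitIso.symm ≪≫ Functor.rightUnitor _
  · rw [← le_obj_iff t DerivedCategory.TStructure.t Φ hle hge]
    exact (DerivedCategory.TStructure.t.le n).prop_iff_of_iso (e.counitIso.symm.app X)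
  · rw [← ge_obj_iff t DerivedCategory.TStructure.t Φ hle hge]
    exact (DerivedCategory.TStructure.t.ge n).prop_iff_of_iso (e.counitIso.symm.app X)

end Realization

/-! ### Orthogonality in K(E) as a lifting property. -/

section Cocycles

variable {E : Type u} [Category.{v} E] [Preadditive E] [HasZeroObject E]

open CochainComplex.HomComplex

/-- A map M ⟶ Kʲ killed by the differential is a chain map from M placed in degree j, and a
null-homotopy of it is a factorization through Kʲ⁻¹. -/
lemma exists_comp_d_eq_of_single_hom_eq_zero {K : CochainComplex E ℤ} {M : E} {i j k : ℤ}
    (hij : i + 1 = j) (hjk : j + 1 = k) (f : M ⟶ K.X j) (hf : f ≫ K.d j k = 0)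
    (hK : ∀ g : (HomotopyCategory.singleFunctor E j).obj M ⟶
      (HomotopyCategory.quotient E (ComplexShape.up ℤ)).obj K, g = 0) :
    ∃ g : M ⟶ K.X i, g ≫ K.d i j = f := by
  let z : Cocycle ((CochainComplex.singleFunctor E j).obj M) K 0 :=
    Cocycle.fromSingleMk f (add_zero j) k hjk hf
  obtain ⟨γ⟩ := nonempty_homotopy_zero_of_quotient_map_eq_zero z.homOf (hK _)
  rw [← Cocycle.fromSingleMk_mem_coboundaries_iff f (add_zero j) k hjk hf i hij,
    mem_coboundaries_iff _ (-1) (by lia)]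
  obtain ⟨β, hβ⟩ := Cochain.equivHomotopy _ _ γ
  refine ⟨β, ?_⟩
  rw [Cocycle.cochain_ofHom_homOf_eq_coe, Cochain.ofHom_zero, add_zero] at hβ
  exact hβ.symm

lemma exists_d_comp_eq_of_hom_single_eq_zero {K : CochainComplex E ℤ} {M : E} {i j k : ℤ}
    (hij : i + 1 = j) (hjk : j + 1 = k) (f : K.X j ⟶ M) (hf : K.d i j ≫ f = 0)
    (hK : ∀ g : (HomotopyCategory.quotient E (ComplexShape.up ℤ)).obj K ⟶
      (HomotopyCategory.singleFunctor E j).obj M, g = 0) :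
    ∃ g : K.X k ⟶ M, K.d j k ≫ g = f := by
  let z : Cocycle K ((CochainComplex.singleFunctor E j).obj M) 0 :=
    Cocycle.toSingleMk f (add_zero j) i hij hf
  obtain ⟨γ⟩ := nonempty_homotopy_zero_of_quotient_map_eq_zero z.homOf (hK _)
  rw [← Cocycle.toSingleMk_mem_coboundaries_iff f (add_zero j) i hij hf k hjk,
    mem_coboundaries_iff _ (-1) (by lia)]
  obtain ⟨β, hβ⟩ := Cochain.equivHomotopy _ _ γ
  refine ⟨β, ?_⟩
  rw [Cocycle.cochain_ofHom_homOf_eq_coe, Cochain.ofHom_zero, add_zero] at hβ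
  exact hβ.symm

end Cocycles

/-! ### t-exactness of the functor to the derived category. -/

section TExactness

variable {E : Type u} [Category.{v} E] [Preadditive E]
  {A : Type*} [Category* A] [Abelian A] (J : E ⥤ A) [J.Additive]

section

variable [J.Full] [J.Faithful]

lemma map_exact_of_projective [EnoughProjectives A] (hJ : ∀ X : A, Projective X ↔ J.essImage X)
    (S : ShortComplex E)
    (hS : ∀ (M : E) (f : M ⟶ S.X₂), f ≫ S.g = 0 → ∃ g, g ≫ S.f = f) : (S.map J).Exact := by
  refine exact_of_projective _ (fun P hP f hf ↦ ?_)
  obtain ⟨M, ⟨e⟩⟩ := (hJ P).1 hP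
  change P ⟶ J.obj S.X₂ at f
  change f ≫ J.map S.g = 0 at hf
  change ∃ g, g ≫ J.map S.f = f
  obtain ⟨f', hf'⟩ := J.map_surjective (e.hom ≫ f)
  obtain ⟨g, hg⟩ := hS M f' (J.map_injective (by simp [hf', hf]))
  refine ⟨e.inv ≫ J.map g, ?_⟩
  rw [Category.assoc, ← J.map_comp, hg, hf', e.inv_hom_id_assoc]

lemma map_exact_of_injective [EnoughInjectives A] (hJ : ∀ X : A, Injective X ↔ J.essImage X)
    (S : ShortComplex E)
    (hS : ∀ (M : E) (f : S.X₂ ⟶ M), S.f ≫ f = 0 → ∃ g, S.g ≫ g = f) : (S.map J).Exact := by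
  refine exact_of_injective _ (fun I hI f hf ↦ ?_)
  obtain ⟨M, ⟨e⟩⟩ := (hJ I).1 hI
  change J.obj S.X₂ ⟶ I at f
  change J.map S.f ≫ f = 0 at hf
  change ∃ g, J.map S.g ≫ g = f
  obtain ⟨f', hf'⟩ := J.map_surjective (f ≫ e.inv)
  obtain ⟨g, hg⟩ := hS M f' (J.map_injective (by simp [hf', reassoc_of% hf]))
  refine ⟨J.map g ≫ e.hom, ?_⟩
  rw [← Category.assoc, ← J.map_comp, hg, hf', Category.assoc, e.inv_hom_id, Category.comp_id]

end

variable [HasDerivedCategory A]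

lemma toDerived_isLE_of_homotopyLE {X : HomotopyCategory E (ComplexShape.up ℤ)} {n : ℤ}
    (hX : homotopyLE E n X) : ((toDerived J).obj X).IsLE n := by
  obtain ⟨K, hK, ⟨e⟩⟩ := hX
  let L : CochainComplex A ℤ := (J.mapHomologicalComplex (.up ℤ)).obj K
  have : L.IsStrictlyLE n := by
    rw [CochainComplex.isStrictlyLE_iff] at hK ⊢
    exact fun i hi ↦ J.map_isZero (hK i hi)
  have : (DerivedCategory.Q.obj L).IsLE n := inferInstance
  let e' : (toDerived J).obj X ≅ DerivedCategory.Q.obj L :=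
    (toDerived J).mapIso e ≪≫ (DerivedCategory.quotientCompQhIso A).app L
  exact DerivedCategory.TStructure.t.isLE_of_iso e'.symm n

lemma toDerived_isGE_of_homotopyGE {X : HomotopyCategory E (ComplexShape.up ℤ)} {n : ℤ}
    (hX : homotopyGE E n X) : ((toDerived J).obj X).IsGE n := by
  obtain ⟨K, hK, ⟨e⟩⟩ := hX
  let L : CochainComplex A ℤ := (J.mapHomologicalComplex (.up ℤ)).obj K
  have : L.IsStrictlyGE n := by
    rw [CochainComplex.isStrictlyGE_iff] at hK ⊢
    exact fun i hi ↦ J.map_isZero (hK i hi)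
  have : (DerivedCategory.Q.obj L).IsGE n := inferInstance
  let e' : (toDerived J).obj X ≅ DerivedCategory.Q.obj L :=
    (toDerived J).mapIso e ≪≫ (DerivedCategory.quotientCompQhIso A).app L
  exact DerivedCategory.TStructure.t.isGE_of_iso e'.symm n

variable [HasZeroObject E] [J.Full] [J.Faithful]

/-- Orthogonality to objects of E placed in degrees i ≤ m says that cocycles of those degrees with
source in E are coboundaries. Since E supplies the projectives, this is exactness in all degrees <
n. -/
lemma toDerived_isGE_of_projective [EnoughProjectives A]
    (hJ : ∀ X : A, Projective X ↔ J.essImage X) {X : HomotopyCategory E (ComplexShape.up ℤ)}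
    {n m : ℤ} (hnm : m + 1 = n) (hX : (homotopyLE E m).rightOrthogonal X) :
    ((toDerived J).obj X).IsGE n := by
  obtain ⟨K, rfl⟩ := HomotopyCategory.quotient_obj_surjective X
  let L : CochainComplex A ℤ := (J.mapHomologicalComplex (.up ℤ)).obj K
  have : L.IsGE n := by
    rw [CochainComplex.isGE_iff]
    intro i hi
    rw [HomologicalComplex.exactAt_iff' _ (i - 1) i (i + 1) (by simp) (by simp)]
    exact map_exact_of_projective J hJ (K.sc' (i - 1) i (i + 1)) (fun M f hf ↦
      exists_comp_d_eq_of_single_hom_eq_zero (by lia) rfl f hf (fun g ↦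
        hX g (homotopyLE_monotone (show i ≤ m by lia) _ (homotopyLE_singleFunctor_obj M i))))
  have : (DerivedCategory.Q.obj L).IsGE n := inferInstance
  exact DerivedCategory.TStructure.t.isGE_of_iso (X := DerivedCategory.Q.obj L)
    ((DerivedCategory.quotientCompQhIso A).app L).symm n

lemma toDerived_isLE_of_injective [EnoughInjectives A]
    (hJ : ∀ X : A, Injective X ↔ J.essImage X) {X : HomotopyCategory E (ComplexShape.up ℤ)}
    {n m : ℤ} (hnm : n + 1 = m) (hX : (homotopyGE E m).leftOrthogonal X) :
    ((toDerived J).obj X).IsLE n := by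
  obtain ⟨K, rfl⟩ := HomotopyCategory.quotient_obj_surjective X
  let L : CochainComplex A ℤ := (J.mapHomologicalComplex (.up ℤ)).obj K
  have : L.IsLE n := by
    rw [CochainComplex.isLE_iff]
    intro i hi
    rw [HomologicalComplex.exactAt_iff' _ (i - 1) i (i + 1) (by simp) (by simp)]
    exact map_exact_of_injective J hJ (K.sc' (i - 1) i (i + 1)) (fun M f hf ↦
      exists_d_comp_eq_of_hom_single_eq_zero (by lia) rfl f hf (fun g ↦
        hX g (homotopyGE_antitone (show m ≤ i by lia) _ (homotopyGE_singleFunctor_obj M i))))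
  have : (DerivedCategory.Q.obj L).IsLE n := inferInstance
  exact DerivedCategory.TStructure.t.isLE_of_iso (X := DerivedCategory.Q.obj L)
    ((DerivedCategory.quotientCompQhIso A).app L).symm n

end TExactness

/-! ### Equivalences of homotopy categories and acyclic complexes. -/

section Equivalences

variable {E I A : Type*} [Category* E] [Category* I] [Category* A] [Preadditive E] [Preadditive I]

lemma mapHomotopyCategory_isEquivalence (F : E ⥤ I) [F.Additive] [F.IsEquivalence] :
    (F.mapHomotopyCategory (ComplexShape.up ℤ)).IsEquivalence := by
  have : (F.mapHomotopyCategory (ComplexShape.up ℤ)).EssSurj := ⟨fun X ↦ by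
    obtain ⟨K, rfl⟩ := HomotopyCategory.quotient_obj_surjective X
    obtain ⟨L, ⟨e⟩⟩ := exists_mapHomologicalComplex_iso F K (fun _ ↦ Functor.EssSurj.mem_essImage _ _)
    exact ⟨(HomotopyCategory.quotient _ _).obj L, ⟨(HomotopyCategory.quotient _ _).mapIso e⟩⟩⟩
  exact { }

variable [Abelian A] [HasDerivedCategory A]

/-- The functor `toDerived` is compatible with the precomposition with an additive functor. -/
noncomputable def mapHomotopyCategoryCompToDerivedIso {F : E ⥤ I} {G : I ⥤ A} {J : E ⥤ A}
    [F.Additive] [G.Additive] [J.Additive] (e : F ⋙ G ≅ J) :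
    F.mapHomotopyCategory (ComplexShape.up ℤ) ⋙ toDerived G ≅ toDerived J :=
  (Functor.associator _ _ _).symm ≪≫
    Functor.isoWhiskerRight (Functor.mapHomotopyCategoryCompIso e _) DerivedCategory.Qh

lemma toDerived_isEquivalence_of_iso {F : E ⥤ I} {G : I ⥤ A} {J : E ⥤ A}
    [F.Additive] [G.Additive] [J.Additive] (e : F ⋙ G ≅ J) [F.IsEquivalence]
    [(toDerived J).IsEquivalence] : (toDerived G).IsEquivalence := by
  have := mapHomotopyCategory_isEquivalence F
  have := Functor.isEquivalence_of_iso (mapHomotopyCategoryCompToDerivedIso e).symm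
  exact Functor.isEquivalence_of_comp_left (F.mapHomotopyCategory (ComplexShape.up ℤ)) _

lemma isZero_Qh_obj_of_acyclic {X : HomotopyCategory A (ComplexShape.up ℤ)}
    (hX : HomotopyCategory.subcategoryAcyclic A X) : IsZero (DerivedCategory.Qh.obj X) := by
  obtain ⟨K, rfl⟩ := HomotopyCategory.quotient_obj_surjective X
  rw [HomotopyCategory.quotient_obj_mem_subcategoryAcyclic_iff_acyclic] at hX
  have h₁ : CochainComplex.IsLE K (-1) :=
    (CochainComplex.isLE_iff _ _).2 fun i _ ↦ hX i
  have h₂ : CochainComplex.IsGE K 0 :=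
    (CochainComplex.isGE_iff _ _).2 fun i _ ↦ hX i
  have h₃ : (DerivedCategory.Q.obj K).IsLE (-1) := inferInstance
  have h₄ : (DerivedCategory.Q.obj K).IsGE 0 := inferInstance
  exact (DerivedCategory.TStructure.t.isZero (DerivedCategory.Q.obj K) (-1) 0 (by lia)).of_iso
    ((DerivedCategory.quotientCompQhIso A).app K)

/-- An acyclic complex vanishes in the derived category, and the faithful functor `toDerived G`
reflects zero objects. For both hearts this makes the class of acyclic complexes the zero class. -/
lemma mapHomotopyCategory_obj_acyclic_iff_isZero (G : I ⥤ A) [G.Additive]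
    [(toDerived G).IsEquivalence] (X : HomotopyCategory I (ComplexShape.up ℤ)) :
    HomotopyCategory.subcategoryAcyclic A
      ((G.mapHomotopyCategory (ComplexShape.up ℤ)).obj X) ↔ IsZero X := by
  refine ⟨fun hX ↦ ?_, fun hX ↦
    ObjectProperty.prop_of_isZero _ (Functor.map_isZero _ hX)⟩
  have := isZero_Qh_obj_of_acyclic hX
  rw [IsZero.iff_id_eq_zero] at this ⊢
  exact (toDerived G).map_injective (by simpa using this)

end Equivalences

lemma trW_le_isomorphisms {C : Type*} [Category* C] [Preadditive C] [HasZeroObject C]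
    [HasShift C ℤ] [∀ n : ℤ, (shiftFunctor C n).Additive] [Pretriangulated C]
    (P : ObjectProperty C) (hP : ∀ X, P X → IsZero X) :
    P.trW ≤ MorphismProperty.isomorphisms C := by
  rintro X Y f ⟨Z, g, h, hT, hZ⟩
  exact (Triangle.isZero₃_iff_isIso₁ _ hT).1 (hP Z hZ)

/-! ### The tilting pair. -/

section

variable {E : Type u} [Category.{v} E] [Preadditive E] [HasZeroObject E]
  [HasBinaryBiproducts E] [HasKernels E] [HasCokernels E]

lemma leftTStructure_heart_single (X : E) :
    (leftTStructure E).heart ((HomotopyCategory.singleFunctor E 0).obj X) :=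
  (heart_inf_heart_eq_essImage.symm.le _ ((HomotopyCategory.singleFunctor E 0).obj_mem_essImage X)).2

lemma rightTStructure_heart_single (X : E) :
    (rightTStructure E).heart ((HomotopyCategory.singleFunctor E 0).obj X) :=
  (heart_inf_heart_eq_essImage.symm.le _ ((HomotopyCategory.singleFunctor E 0).obj_mem_essImage X)).1

variable (E)

lemma leftTStructure_toDerived_isEquivalence :
    (toDerived (toHeart (leftTStructure E) leftTStructure_heart_single)).IsEquivalence := by
  have := leftTStructure_enoughProjectives E
  exact toDerived_isEquivalence_of_projective _
    (fun X ↦ by rw [toHeart_essImage, leftTStructure_projective_iff])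
    2 leftTStructure_hasProjectiveDimensionLT

lemma rightTStructure_toDerived_isEquivalence :
    (toDerived (toHeart (rightTStructure E) rightTStructure_heart_single)).IsEquivalence := by
  have := rightTStructure_enoughInjectives E
  exact toDerived_isEquivalence_of_injective _
    (fun X ↦ by rw [toHeart_essImage, rightTStructure_injective_iff])
    2 rightTStructure_hasInjectiveDimensionLT

lemma leftTStructure_exists_isDerivedRealization :
    have := leftTStructure_toDerived_isEquivalence E
    ∃ (_ : (toDerived (toHeart (leftTStructure E)
        leftTStructure_heart_single)).asEquivalence.inverse.CommShift ℤ),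
      IsDerivedRealization (leftTStructure E) (toDerived (toHeart (leftTStructure E)
        leftTStructure_heart_single)).asEquivalence.inverse := by
  have := leftTStructure_toDerived_isEquivalence E
  have := leftTStructure_enoughProjectives E
  have hJ (X : (leftTStructure E).heart.FullSubcategory) :
      Projective X ↔ (toHeart (leftTStructure E) leftTStructure_heart_single).essImage X := by
    rw [toHeart_essImage, leftTStructure_projective_iff]
  refine exists_isDerivedRealization _ leftTStructure_heart_single
    (fun X hX ↦ (toDerived_isLE_of_homotopyLE _ hX).le)
    (fun X hX ↦ (toDerived_isGE_of_projective _ hJ (m := 0 - 1) (by lia) hX).ge)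
    (fun Θ _ _ _ β ↦ nonempty_iso_id_of_projective _
      (fun M ↦ (hJ _).2 (Functor.obj_mem_essImage _ M)) (fun X ↦ ?_) Θ β)
  obtain ⟨K, P, i, p, w, hS, hP⟩ := leftTStructure_exists_shortExact X
  rw [← toHeart_essImage _ leftTStructure_heart_single] at hP
  obtain ⟨M, ⟨e⟩⟩ := hP
  have : Epi p := hS.epi_g
  exact ⟨M, e.hom ≫ p, inferInstance⟩

lemma rightTStructure_exists_isDerivedRealization :
    have := rightTStructure_toDerived_isEquivalence E
    ∃ (_ : (toDerived (toHeart (rightTStructure E)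
        rightTStructure_heart_single)).asEquivalence.inverse.CommShift ℤ),
      IsDerivedRealization (rightTStructure E) (toDerived (toHeart (rightTStructure E)
        rightTStructure_heart_single)).asEquivalence.inverse := by
  have := rightTStructure_toDerived_isEquivalence E
  have := rightTStructure_enoughInjectives E
  have hJ (X : (rightTStructure E).heart.FullSubcategory) :
      Injective X ↔ (toHeart (rightTStructure E) rightTStructure_heart_single).essImage X := by
    rw [toHeart_essImage, rightTStructure_injective_iff]
  refine exists_isDerivedRealization _ rightTStructure_heart_single
    (fun X hX ↦ (toDerived_isLE_of_injective _ hJ (m := 0 + 1) (by lia) hX).le)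
    (fun X hX ↦ (toDerived_isGE_of_homotopyGE _ hX).ge)
    (fun Θ _ _ _ β ↦ nonempty_iso_id_of_injective _
      (fun M ↦ (hJ _).2 (Functor.obj_mem_essImage _ M)) (fun X ↦ ?_) Θ β)
  obtain ⟨I, Q, i, p, w, hS, hI⟩ := rightTStructure_exists_shortExact X
  rw [← toHeart_essImage _ rightTStructure_heart_single] at hI
  obtain ⟨M, ⟨e⟩⟩ := hI
  have : Mono i := hS.mono_f
  exact ⟨M, i ≫ e.inv, inferInstance⟩

/-- The functor which sends an object of `E` to the complex concentrated in degree `0`, with values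
in the intersection of the hearts of the left and right t-structures. -/
noncomputable abbrev toInter : E ⥤ Inter (rightTStructure E) (leftTStructure E) :=
  ObjectProperty.lift _ (HomotopyCategory.singleFunctor E 0)
    (fun X ↦ ⟨rightTStructure_heart_single X, leftTStructure_heart_single X⟩)

instance toInter_additive : (toInter E).Additive where
  map_add {_ _ _ _} := by
    ext
    exact (HomotopyCategory.singleFunctor E 0).map_add

lemma toInter_isEquivalence : (toInter E).IsEquivalence := by
  have := singleFunctor_full E
  have := singleFunctor_faithful E
  have : (toInter E).EssSurj := ⟨fun X ↦ by
    obtain ⟨M, ⟨e⟩⟩ := heart_inf_heart_eq_essImage.le _ X.property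
    exact ⟨M, ⟨ObjectProperty.isoMk _ e⟩⟩⟩
  exact { }

lemma isTiltingPair_rightTStructure_leftTStructure :
    IsTiltingPair (rightTStructure E) (leftTStructure E) 2 := by
  have := toInter_isEquivalence E
  have := mapHomotopyCategory_isEquivalence (toInter E)
  have := leftTStructure_toDerived_isEquivalence E
  have := rightTStructure_toDerived_isEquivalence E
  let e₁ : toInter E ⋙ interToFst (rightTStructure E) (leftTStructure E) ≅
    toHeart (rightTStructure E) rightTStructure_heart_single := Iso.refl _
  let e₂ : toInter E ⋙ interToSnd (rightTStructure E) (leftTStructure E) ≅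
    toHeart (leftTStructure E) leftTStructure_heart_single := Iso.refl _
  have h₁ : (toDerivedFst (rightTStructure E) (leftTStructure E)).IsEquivalence :=
    toDerived_isEquivalence_of_iso e₁
  have h₂ : (toDerivedSnd (rightTStructure E) (leftTStructure E)).IsEquivalence :=
    toDerived_isEquivalence_of_iso e₂
  have hFst (X) : acyclicFst (rightTStructure E) (leftTStructure E) X ↔ IsZero X :=
    mapHomotopyCategory_obj_acyclic_iff_isZero (interToFst _ _) X
  have hSnd (X) : acyclicSnd (rightTStructure E) (leftTStructure E) X ↔ IsZero X :=
    mapHomotopyCategory_obj_acyclic_iff_isZero (interToSnd _ _) X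
  refine
    { le_neg_le := rightTStructure_le_le_leftTStructure_le 0 (-2) (by lia)
      le_zero_le := leftTStructure_le_le_rightTStructure_le 0
      acyclic_eq := by ext X; rw [hFst, hSnd]
      -- Only zero objects are acyclic, so the morphisms to be inverted are already isomorphisms and
      -- any equivalence is a localization.
      isLocalization_fst := Functor.IsLocalization.of_isEquivalence _ _
        (trW_le_isomorphisms _ fun X ↦ (hFst X).1)
      isLocalization_snd := Functor.IsLocalization.of_isEquivalence _ _
        (trW_le_isomorphisms _ fun X ↦ (hSnd X).1)
      exists_realizations := ?_
      cogenerates := fun X ↦ ?_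
      generates := fun X ↦ ?_ }
  · obtain ⟨_, hF⟩ := rightTStructure_exists_isDerivedRealization E
    obtain ⟨_, hG⟩ := leftTStructure_exists_isDerivedRealization E
    refine ⟨_, _, _, _, hF, hG, ⟨?_⟩⟩
    let e₁' := mapHomotopyCategoryCompToDerivedIso e₁
    let e₂' := mapHomotopyCategoryCompToDerivedIso e₂
    -- Both functors are compared after precomposition with the equivalence from K(E), where each
    -- becomes an equivalence followed by its inverse, hence the identity of K(E).
    refine ((Functor.whiskeringLeft _ _ _).obj
      ((toInter E).mapHomotopyCategory (ComplexShape.up ℤ))).preimageIso ?_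
    let Φ₁ := toDerived (toHeart (rightTStructure E) rightTStructure_heart_single)
    let Φ₂ := toDerived (toHeart (leftTStructure E) leftTStructure_heart_single)
    exact (Functor.associator _ _ _).symm ≪≫ Functor.isoWhiskerRight e₁' _ ≪≫
      Φ₁.asEquivalence.unitIso.symm ≪≫ Φ₂.asEquivalence.unitIso ≪≫
      Functor.isoWhiskerRight e₂'.symm _ ≪≫ Functor.associator _ _ _
  · obtain ⟨I, Q, i, p, w, hS, hI⟩ := rightTStructure_exists_shortExact X
    exact ⟨I, i, (heart_inf_heart_eq_essImage.symm.le _ hI).2, hS.mono_f⟩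
  · obtain ⟨K, P, i, p, w, hS, hP⟩ := leftTStructure_exists_shortExact X
    exact ⟨P, p, (heart_inf_heart_eq_essImage.symm.le _ hP).1, hS.epi_g⟩

lemma leftTStructure_exists_projectiveResolution (X : (leftTStructure E).heart.FullSubcategory) :
    ∃ P : ProjectiveResolution X, (∀ i, inHeart (leftTStructure E) (P.complex.X i)) ∧
      ∀ i, 2 < i → IsZero (P.complex.X i) := by
  obtain ⟨K, P₀, P₁, P₂, i, p, w, j, s, w', hS, hT, h₀, h₁, h₂⟩ :=
    leftTStructure_exists_resolution X
  have := leftTStructure_projective h₀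
  have := leftTStructure_projective h₁
  have := leftTStructure_projective h₂
  exact exists_projectiveResolution_of_shortExact (inHeart (leftTStructure E)) hS hT
    (isZero_zero _) h₀ h₁ h₂
    ((leftTStructure_projective_iff _).1 (Projective.zero_projective))

end

end TiltingPair

theorem propositionP {E : Type u} [Category.{v} E] [Preadditive E] [HasZeroObject E]
    [HasBinaryBiproducts E] [HasKernels E] [HasCokernels E] :
    ∃ R L : TStructure (HomotopyCategory E (ComplexShape.up ℤ)),
      IsRightTStructure R ∧ IsLeftTStructure L ∧
      IsTiltingPair R L 2 ∧
      (HomotopyCategory.singleFunctor E 0).Full ∧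
      (HomotopyCategory.singleFunctor E 0).Faithful ∧
      R.heart ⊓ L.heart = (HomotopyCategory.singleFunctor E 0).essImage ∧
      IsTwoTiltingTorsionClass (inHeart R) ∧
      IsTwoCotiltingTorsionFreeClass (inHeart L) ∧
      (∀ X : L.heart.FullSubcategory, Projective X ↔ inHeart L X) ∧
      (∀ X : L.heart.FullSubcategory, ∃ P : ProjectiveResolution X,
        (∀ i, inHeart L (P.complex.X i)) ∧ ∀ i, 2 < i → IsZero (P.complex.X i)) ∧
      ∃ h : ∀ X : E, L.heart ((HomotopyCategory.singleFunctor E 0).obj X),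
        ((toHeart L h).mapHomotopyCategory (ComplexShape.up ℤ) ⋙
          DerivedCategory.Qh).IsEquivalence := by
  have := rightTStructure_enoughInjectives E
  have := leftTStructure_enoughProjectives E
  exact ⟨rightTStructure E, leftTStructure E, rightTStructure_isRightTStructure E,
    leftTStructure_isLeftTStructure E, isTiltingPair_rightTStructure_leftTStructure E,
    singleFunctor_full E, singleFunctor_faithful E, heart_inf_heart_eq_essImage,
    isTwoTiltingTorsionClass_of_injective _ (fun X ↦ rightTStructure_injective_iff X)
      rightTStructure_hasInjectiveDimensionLT
      (hasKernels_inHeart _ rightTStructure_heart_single),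
    isTwoCotiltingTorsionFreeClass_of_projective _ (fun X ↦ leftTStructure_projective_iff X)
      leftTStructure_hasProjectiveDimensionLT
      (hasCokernels_inHeart _ leftTStructure_heart_single),
    leftTStructure_projective_iff, leftTStructure_exists_projectiveResolution E,
    leftTStructure_heart_single, leftTStructure_toDerived_isEquivalence E⟩
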